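/- Let $l\ge 4$ be even. Take a round disc in the plane and plumb $l$ Hopf bands $H_0,\dots,H_{l-1}$ to it, arranged clockwise around the disc so that exactly the core curves $c_i,c_{i+1}$ of cyclically consecutive bands intersect (once, inside the disc), alternately positive and negative ($H_i$ is positive for even $i$ and negative for odd $i$). The bands are plumbed one after the other, in the order of a word $w$ in the Dehn twists $T_{c_0},\dots,T_{c_{l-1}}$ containing every twist exactly once, each new band on top of the surface already built (so of two neighbouring bands the later one runs above the earlier one). The boundary of the resulting surface is an oriented link $L_w$; it is a fibred link realising the Penner mapping class given by $w$ on curves that intersect in the pattern of a cycle of length $l$. The flow difference of $w$ is the number of $i\in\mathbf{Z}/l$ such that $T_{c_i}$ occurs in $w$ before $T_{c_{i+1}}$, minus the number of $i\in\mathbf{Z}/l$ such that it occurs after $T_{c_{i+1}}$. The Alexander polynomial $\Delta_L\in\mathbf{Z}[\sqrt t^{\,\pm1}]$ of an oriented link $L$ is the isotopy invariant determined by the value $1$ on the unknot and the skein relation $\Delta_{L_+}=\Delta_{L_-}+\left(\sqrt t-\frac1{\sqrt t}\right)\Delta_{L_0}$. Let $d\ge 0$ be an integer. If $w$ and $w'$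 are two such words with flow differences $d$ and $d+2$ respectively, then, writing $\Delta_{d,l}=\Delta_{L_w}$ and $\Delta_{d+2,l}=\Delta_{L_{w'}}$, $$\Delta_{d,l}-\Delta_{d+2,l}=\left(\sqrt t-\frac1{\sqrt t}\right)\left(\sqrt t^{\,d+1}-\sqrt t^{\,-(d+1)}\right).$$ -/

import Mathlib

/-! Oriented link diagrams in the plane, in Morse position, their isotopy moves, the Alexander
polynomial given by the skein relation, and the links bounding cyclic plumbings of Hopf bands. -/

namespace HopfPlumbing

open LaurentPolynomial

/-- The elementary pieces of a diagram, read from bottom to top.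
`cup b` is a local minimum which creates two neighbouring strands; the left one points upwards
if `b = true` and downwards if `b = false`, the right one points the other way.
`cap` is a local maximum, joining two neighbouring strands.
`cross e` is a crossing of two neighbouring strands; for `e = true` the strand running from
bottom left to top right is the upper one, for `e = false` it is the lower one. -/
inductive Gen where
  | cup (b : Bool)
  | cap
  | cross (e : Bool)

/-- Number of strands that enter the piece from below. -/
def Gen.bot : Gen → ℕ
  | .cup _ => 0
  | .cap => 2
  | .cross _ => 2

/-- Number of strands that leave the piece at the top. -/
def Gen.top : Gen → ℕ
  | .cup _ => 2
  | .cap => 0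
  | .cross _ => 2

/-- A layer `(i, g)` of a diagram: the piece `g` with exactly `i` vertical strands on its left. -/
abbrev Layer := ℕ × Gen

/-- The directions of the strands above a layer, given the directions below it, listed from left
to right (`true` is upwards); `none` if the layer does not fit. -/
def step (st : List Bool) : Layer → Option (List Bool)
  | (i, .cup b) => if i ≤ st.length then some (st.take i ++ b :: (!b) :: st.drop i) else none
  | (i, .cap) =>
    match st.drop i with
    | a :: c :: v => if a = c then none else some (st.take i ++ v)
    | _ => none
  | (i, .cross _) =>
    match st.drop i with
    | a :: c :: v => some (st.take i ++ c :: a :: v)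
    | _ => none

/-- The directions of the strands after a stack of layers. -/
def run (st : List Bool) (D : List Layer) : Option (List Bool) := D.foldlM step st

/-- A stack of layers is an oriented link diagram if the layers fit together consistently with
the orientations, and no strand is left open at the bottom or at the top. -/
def IsLinkDiagram (D : List Layer) : Prop := run [] D = some []

/-- The local moves between Morse diagrams which generate isotopy of links:
exchange of distant pieces, straightening of a strand, the three Reidemeister moves, and the
passage of a strand over or under a local extremum. -/
inductive LocalMove : List Layer → List Layer → Prop
  | exchange (i k : ℕ) (g h : Gen) :
      LocalMove [(i, g), (i + g.top + k, h)] [(i + g.bot + k, h), (i, g)]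
  | straightenLeft (i : ℕ) (b : Bool) : LocalMove [(i + 1, .cup b), (i, .cap)] []
  | straightenRight (i : ℕ) (b : Bool) : LocalMove [(i, .cup b), (i + 1, .cap)] []
  | reidemeister1Cap (i : ℕ) (e : Bool) :
      LocalMove [(i, .cross e), (i, .cap)] [(i, .cap)]
  | reidemeister1Cup (i : ℕ) (b e : Bool) :
      LocalMove [(i, .cup b), (i, .cross e)] [(i, .cup (!b))]
  | reidemeister2 (i : ℕ) (e : Bool) : LocalMove [(i, .cross e), (i, .cross (!e))] []
  | reidemeister3 (i : ℕ) (e : Bool) :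
      LocalMove [(i, .cross e), (i + 1, .cross e), (i, .cross e)]
        [(i + 1, .cross e), (i, .cross e), (i + 1, .cross e)]
  | slideCap (i : ℕ) (e : Bool) :
      LocalMove [(i + 1, .cross e), (i, .cap)] [(i, .cross (!e)), (i + 1, .cap)]
  | slideCup (i : ℕ) (b e : Bool) :
      LocalMove [(i, .cup b), (i + 1, .cross e)] [(i + 1, .cup b), (i, .cross (!e))]

/-- Two link diagrams that differ by one local move. -/
inductive Move : List Layer → List Layer → Prop
  | mk (A B x y : List Layer) (h : LocalMove x y)
      (hx : IsLinkDiagram (A ++ x ++ B)) (hy : IsLinkDiagram (A ++ y ++ B)) :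
      Move (A ++ x ++ B) (A ++ y ++ B)

/-- Isotopy of oriented links, on the level of diagrams. -/
def Isotopic : List Layer → List Layer → Prop := Relation.EqvGen Move

/-- The orientation-preserving smoothing of a crossing of strands with directions `a` (lower left)
and `c` (lower right): two vertical strands if `a = c`, a maximum below a minimum otherwise. -/
def smoothing (i : ℕ) (a c : Bool) : List Layer :=
  if a = c then [] else [(i, .cap), (i, .cup c)]

/-- `SkeinTriple P N Z`: the link diagrams `P`, `N`, `Z` agree except at one crossing, which is
positive in `P`, negative in `N` and smoothed in `Z`. The crossing lies between strands that have
the directions `a` and `c` below it, so it is positive if and only if the strand running from bottom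
left to top right is the upper one and `a = c`, or it is the lower one and `a ≠ c`. -/
inductive SkeinTriple : List Layer → List Layer → List Layer → Prop
  | mk (A B : List Layer) (u v : List Bool) (a c : Bool)
      (hA : run [] A = some (u ++ a :: c :: v))
      (hD : IsLinkDiagram (A ++ [(u.length, .cross (a == c))] ++ B)) :
      SkeinTriple (A ++ [(u.length, .cross (a == c))] ++ B)
        (A ++ [(u.length, .cross (!(a == c)))] ++ B)
        (A ++ smoothing u.length a c ++ B)

/-- The diagram of the unknot without crossings. -/
def unknot : List Layer := [(0, .cup true), (0, .cap)]

/-- `SkeinValue D p`: the Laurent polynomial `p` in the variable `T 1 = √t` is obtained for the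
link diagram `D` recursively from isotopy invariance, the value `1` on the unknot and the skein
relation `Δ(L₊) = Δ(L₋) + (√t - 1/√t) Δ(L₀)`, any two terms of which determine the third. -/
inductive SkeinValue : List Layer → ℤ[T;T⁻¹] → Prop
  | unknot : SkeinValue unknot 1
  | isotopic {D D' : List Layer} {p : ℤ[T;T⁻¹]} (h : Isotopic D D') (hp : SkeinValue D p) :
      SkeinValue D' p
  | positive {P N Z : List Layer} {n z : ℤ[T;T⁻¹]} (h : SkeinTriple P N Z)
      (hn : SkeinValue N n) (hz : SkeinValue Z z) : SkeinValue P (n + (T 1 - T (-1)) * z)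
  | negative {P N Z : List Layer} {p z : ℤ[T;T⁻¹]} (h : SkeinTriple P N Z)
      (hp : SkeinValue P p) (hz : SkeinValue Z z) : SkeinValue N (p - (T 1 - T (-1)) * z)
  | smoothed {P N Z : List Layer} {p n z : ℤ[T;T⁻¹]} (h : SkeinTriple P N Z)
      (hp : SkeinValue P p) (hn : SkeinValue N n) (hz : p = n + (T 1 - T (-1)) * z) :
      SkeinValue Z z

/-- `p` is the Alexander polynomial of the link with diagram `D`: the skein relation gives the
value `p` for `D`, and no other one. -/
def IsAlexanderPolynomial (D : List Layer) (p : ℤ[T;T⁻¹]) : Prop :=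
  ∀ x : ℤ[T;T⁻¹], SkeinValue D x ↔ x = p

/-! The curves `c_0, …, c_{l-1}` intersect in the pattern of a cycle, numbered clockwise. A product
of the Dehn twists in which every twist occurs exactly once is recorded by the permutation `w`
for which `w i` is the place of the twist along `c_i` in the product. -/

/-- The flow difference: the edge between `c_i` and the next curve `c_{i+1}` (indices modulo `l`)
is directed clockwise if the twist along `c_i` occurs before the twist along `c_{i+1}`, and
anticlockwise otherwise; count clockwise edges minus anticlockwise ones. -/
def flowDifference {l : ℕ} (w : Equiv.Perm (Fin l)) : ℤ :=
  ∑ i : Fin l, if w i < w (finRotate l i) then 1 else -1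

/-- A full twist in a band whose edges are the strands `0` and `1`, which have opposite
directions. Its two crossings are positive if `pos = true` (positive Hopf band) and negative
otherwise. -/
def fullTwist (pos : Bool) : List Layer := [(0, .cross (!pos)), (0, .cross (!pos))]

/-- The sector of the diagram in which a band ends and the next one begins. Below and above it, the
strands `0` and `1` are the outer and the inner edge of the only band present, and strand `2` is
the boundary of the disc, which lies on the right. Inside the sector, strand `2` leaves the
disc as the outer edge of the next band, whose inner edge is created by the cup. The old band
crosses the next band (four crossings) on its way to the disc: over it if `o = true`, under
it otherwise. There its outer edge becomes the boundary of the disc, and its inner edge turns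
back, along a short piece of the boundary of the disc, into the inner edge of the next band. -/
def bandCrossing (o : Bool) : List Layer :=
  [(3, .cup true), (1, .cross o), (0, .cross o), (2, .cross o), (1, .cross o),
    (3, .cap)]

/-- The boundary link of the surface obtained from a round disc by plumbing `l` Hopf bands
`H_0, …, H_{l-1}`, arranged clockwise around the disc such that exactly cyclically consecutive core
curves intersect (once, in the disc). `H_i` is positive for even `i` and negative for odd `i`. The
bands are plumbed on top of the surface in the order given by `w`, so of two neighbouring bands
the one plumbed later runs above the other. The first and the last three layers close up the
stack of sectors around the disc; the boundary of the disc is oriented anticlockwise. -/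
def plumbingLink {l : ℕ} (w : Equiv.Perm (Fin l)) : List Layer :=
  [(0, .cup false), (1, .cup true), (2, .cup false)] ++
    (List.finRange l).flatMap (fun i : Fin l =>
      fullTwist (decide (Even (i : ℕ))) ++ bandCrossing (decide (w (finRotate l i) < w i))) ++
    [(2, .cap), (1, .cap), (0, .cap)]

end HopfPlumbing

/-! Uniqueness of the polynomial. The skein rules are shown to be consistent by a state sum of
$U_q(\mathfrak{gl}(1|1))$ type: each strand is empty or occupied, and every piece of a diagram acts
on functions of such states. The closed state sum is identically zero, so the diagram is cut open at
its first minimum. An odd symmetry commuting with all pieces shows that the choice of the cut does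
not matter. The result is an isotopy invariant satisfying the skein relation, hence it equals every
value derivable by `SkeinValue` (`SkeinValue.eq_stateSum`).

Existence and computation. Each sector of the plumbing diagram is isotopic to a half twist of three
strands (`bandCrossing_halfTwist`), so $L_w$ is the closure of a word in full twists of two strands
and half twists of three strands; only the signs of the half twists depend on $w$. Resolving a full
twist by the skein relation either deletes it or cuts its band (`SkeinValue.twist`). At a cut,
neighbouring half twists are absorbed by the maxima and minima whatever their signs are, so every
term with a cut is independent of $w$ (`exists_skeinValue_closure_of_cut`). The one remaining term,
with all full twists deleted, is the closure of a power $h^n$ of the half twist, where $n=-d$ is the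
sum of the signs. A skein recursion gives $2-\sqrt t^{\,n}-\sqrt t^{\,-n}$ for even $n$
(`skeinValue_closure_halves`).

Hence $\Delta_{d,l}=p+2-\sqrt t^{\,d}-\sqrt t^{\,-d}$ with $p$ independent of $w$, and subtracting
the values for $d$ and $d+2$ gives the formula. -/

namespace HopfPlumbing

/-! ### The free-fermion state model -/

/-- A strand of a state: its direction and its occupation number. -/
abbrev Strand := Bool × Bool

section StateModel

variable {R : Type*} [CommRing R] (s : Rˣ)

/-- The weight of a minimum whose left strand has the direction `b` and whose two strands have the
occupation number `x`. -/
def cupWeight : Bool → Bool → R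
  | true, _ => 1
  | false, false => s
  | false, true => -s

/-- The weight of a maximum joining two strands. -/
def capWeight : Strand → Strand → R
  | (false, x), (true, y) => if x = y then 1 else 0
  | (true, false), (false, false) => ↑s⁻¹
  | (true, true), (false, true) => -↑s⁻¹
  | _, _ => 0

/-- The weight of a crossing of strands with directions `a`, `c` and occupation numbers `x`, `y`
below the crossing and `x'`, `y'` above it. -/
def crossWeight (e a c : Bool) : Bool → Bool → Bool → Bool → R
  | false, false, false, false => if e = (a == c) then s else ↑s⁻¹
  | true, true, true, true => -(if e = (a == c) then ↑s⁻¹ else s)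
  | false, true, true, false => 1
  | true, false, false, true => 1
  | true, false, true, false =>
      if a = c ∧ e = a then (if e then (s - ↑s⁻¹ : R) else ↑s⁻¹ - s) else 0
  | false, true, false, true =>
      if a = c ∧ e ≠ a then (if e then (s - ↑s⁻¹ : R) else ↑s⁻¹ - s) else 0
  | false, false, true, true => if a ≠ c ∧ e = c then ↑s⁻¹ - s else 0
  | true, true, false, false => if a ≠ c ∧ e = a then s - ↑s⁻¹ else 0
  | _, _, _, _ => 0

/-- The action of a piece of a diagram, on the leftmost strands, on functions of the states. -/
def Gen.act : Gen → (List Strand → R) → List Strand → R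
  | .cup b, Φ, L => cupWeight s b false * Φ ((b, false) :: (!b, false) :: L) +
      cupWeight s b true * Φ ((b, true) :: (!b, true) :: L)
  | .cap, Φ, p :: q :: L => capWeight s p q * Φ L
  | .cross e, Φ, (a, x) :: (c, y) :: L =>
      crossWeight s e a c x y false false * Φ ((c, false) :: (a, false) :: L) +
      crossWeight s e a c x y false true * Φ ((c, false) :: (a, true) :: L) +
      crossWeight s e a c x y true false * Φ ((c, true) :: (a, false) :: L) +
      crossWeight s e a c x y true true * Φ ((c, true) :: (a, true) :: L)
  | _, _, _ => 0

/-- The action of a piece of a diagram with `i` strands on its left. -/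
def actAt (g : Gen) : ℕ → (List Strand → R) → List Strand → R
  | 0, Φ, L => g.act s Φ L
  | _ + 1, _, [] => 0
  | i + 1, Φ, p :: L => actAt g i (fun M => Φ (p :: M)) L

/-- The action of a stack of layers on functions of the states. -/
def actList (D : List Layer) (Φ : List Strand → R) : List Strand → R :=
  D.foldr (fun x Ψ => actAt s x.2 x.1 Ψ) Φ

@[simp] theorem actList_nil (Φ : List Strand → R) : actList s [] Φ = Φ := rfl

@[simp] theorem actList_cons (x : Layer) (D : List Layer) (Φ : List Strand → R) :
    actList s (x :: D) Φ = actAt s x.2 x.1 (actList s D Φ) := rfl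

theorem actList_append (D E : List Layer) (Φ : List Strand → R) :
    actList s (D ++ E) Φ = actList s D (actList s E Φ) := by
  simp [actList]

/-- The directions of the strands of a state. -/
abbrev dirs (L : List Strand) : List Bool := L.map Prod.fst

theorem step_succ (a : Bool) (st : List Bool) (i : ℕ) (g : Gen) :
    step (a :: st) (i + 1, g) = (step st (i, g)).map (a :: ·) := by
  cases g with
  | cup b => by_cases h : i ≤ st.length <;> simp [step, h]
  | cap =>
    simp only [step, List.drop_succ_cons, List.take_succ_cons]
    rcases st.drop i with _ | ⟨p, _ | ⟨q, v⟩⟩ <;> simp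
    split_ifs <;> simp
  | cross e =>
    simp only [step, List.drop_succ_cons, List.take_succ_cons]
    rcases st.drop i with _ | ⟨p, _ | ⟨q, v⟩⟩ <;> simp

theorem step_nil_succ (i : ℕ) (g : Gen) : step [] (i + 1, g) = none := by
  cases g <;> simp [step]

theorem run_cons (st : List Bool) (x : Layer) (D : List Layer) :
    run st (x :: D) = (step st x).bind (fun t => run t D) := rfl

@[simp] theorem run_nil (st : List Bool) : run st [] = some st := rfl

theorem run_append (st : List Bool) (D E : List Layer) :
    run st (D ++ E) = (run st D).bind (fun t => run t E) := by
  induction D generalizing st with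
  | nil => rfl
  | cons x D ih =>
    simp only [List.cons_append, run_cons]
    cases step st x <;> simp [ih]

/-- The value of an action only depends on the states with the directions above the piece. -/
theorem actAt_congr {g : Gen} {i : ℕ} {Φ Ψ : List Strand → R} {L : List Strand} {t : List Bool}
    (ht : step (dirs L) (i, g) = some t) (h : ∀ M, dirs M = t → Φ M = Ψ M) :
    actAt s g i Φ L = actAt s g i Ψ L := by
  induction i generalizing L t Φ Ψ with
  | zero =>
    cases g with
    | cup b =>
      simp [step] at ht
      simp only [actAt, Gen.act]
      rw [h _ (by simp [ht]), h _ (by simp [ht])]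
    | cap =>
      rcases L with _ | ⟨p, _ | ⟨q, L⟩⟩
      · rfl
      · rfl
      · simp [step] at ht
        simp only [actAt, Gen.act]
        rw [h _ (by simp [ht])]
    | cross e =>
      rcases L with _ | ⟨⟨a, x⟩, _ | ⟨⟨c, y⟩, L⟩⟩
      · rfl
      · rfl
      · simp [step] at ht
        simp only [actAt, Gen.act]
        rw [h _ (by simp [ht]), h _ (by simp [ht]), h _ (by simp [ht]), h _ (by simp [ht])]
  | succ i ih =>
    cases L with
    | nil => rfl
    | cons p L =>
      simp only [List.map_cons, step_succ] at ht
      obtain ⟨t', ht', rfl⟩ := Option.map_eq_some_iff.1 ht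
      exact ih ht' fun M hM => h _ (by simp [hM])

theorem actList_congr {D : List Layer} {Φ Ψ : List Strand → R} {L : List Strand} {t : List Bool}
    (ht : run (dirs L) D = some t) (h : ∀ M, dirs M = t → Φ M = Ψ M) :
    actList s D Φ L = actList s D Ψ L := by
  induction D generalizing L with
  | nil => exact h _ (by simpa using ht)
  | cons x D ih =>
    rw [run_cons] at ht
    obtain ⟨t', ht', h'⟩ := Option.bind_eq_some_iff.1 ht
    exact actAt_congr s ht' fun M hM => ih (by rw [hM]; exact h')

theorem Gen.act_linear (g : Gen) (α β : R) (Φ Ψ : List Strand → R) (L : List Strand) :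
    g.act s (fun M => α * Φ M + β * Ψ M) L = α * g.act s Φ L + β * g.act s Ψ L := by
  rcases g with b | _ | e
  · simp only [Gen.act]; ring
  all_goals
    rcases L with _ | ⟨p, _ | ⟨q, L⟩⟩ <;> simp only [Gen.act] <;> ring

theorem actAt_linear (g : Gen) (i : ℕ) (α β : R) (Φ Ψ : List Strand → R) (L : List Strand) :
    actAt s g i (fun M => α * Φ M + β * Ψ M) L = α * actAt s g i Φ L + β * actAt s g i Ψ L := by
  induction i generalizing Φ Ψ L with
  | zero => exact g.act_linear s α β Φ Ψ L
  | succ i ih =>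
    cases L with
    | nil => simp [actAt]
    | cons p L => exact ih _ _ L

/-- A stack of layers with an additional strand on the left. -/
def shiftRight (D : List Layer) : List Layer := D.map fun x => (x.1 + 1, x.2)

theorem run_shiftRight (a : Bool) (st : List Bool) (D : List Layer) :
    run (a :: st) (shiftRight D) = (run st D).map (a :: ·) := by
  induction D generalizing st with
  | nil => rfl
  | cons x D ih =>
    rw [shiftRight, List.map_cons, run_cons, run_cons, step_succ]
    cases step st x with
    | none => rfl
    | some t => exact ih t

theorem actList_shiftRight (p : Strand) (Φ : List Strand → R) (L : List Strand) (D : List Layer) :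
    actList s (shiftRight D) Φ (p :: L) = actList s D (fun M => Φ (p :: M)) L := by
  induction D generalizing L with
  | nil => rfl
  | cons x D ih =>
    simp only [shiftRight, List.map_cons, actList_cons, actAt]
    congr 1
    funext M
    exact ih M

/-- Two stacks of layers act in the same way on all states on which both can be placed. -/
def ActEq (D E : List Layer) : Prop :=
  ∀ (Φ : List Strand → R) (L : List Strand) (t t' : List Bool),
    run (dirs L) D = some t → run (dirs L) E = some t' → actList s D Φ L = actList s E Φ L

/-- This reduces every local move to position `0`. Non-emptiness of `D` rules out the empty state,
on which there is no strand to put on the left. -/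
theorem ActEq.shiftRight {D E : List Layer} (h : ActEq s D E) (hD : D ≠ []) :
    ActEq s (shiftRight D) (shiftRight E) := by
  intro Φ L t t' ht ht'
  cases L with
  | nil =>
    cases D with
    | nil => exact absurd rfl hD
    | cons x D => simp [HopfPlumbing.shiftRight, run_cons, step_nil_succ] at ht
  | cons p L =>
    simp only [List.map_cons, run_shiftRight] at ht ht'
    obtain ⟨u, hu, -⟩ := Option.map_eq_some_iff.1 ht
    obtain ⟨u', hu', -⟩ := Option.map_eq_some_iff.1 ht'
    simpa only [actList_shiftRight] using h _ L u u' hu hu'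

/-! ### Invariance of the action under the local moves -/

theorem actEq_exchange (i k : ℕ) (g h : Gen) :
    ActEq s [(i, g), (i + g.top + k, h)] [(i + g.bot + k, h), (i, g)] := by
  induction i with
  | zero =>
    intro Φ L t t' _ _
    simp only [actList_cons, actList_nil, Nat.zero_add]
    rcases g with b | _ | e
    · simp only [Gen.top, Gen.bot, Nat.zero_add, Nat.add_comm 2 k, actAt, Gen.act]
      exact (actAt_linear s h k _ _ _ _ L).symm
    · simp only [Gen.top, Gen.bot, Nat.zero_add, Nat.add_comm 2 k]
      rcases L with _ | ⟨p, _ | ⟨q, L⟩⟩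
      · rfl
      · rfl
      · simp only [actAt, Gen.act]
        simpa using (actAt_linear s h k (capWeight s p q) 0 Φ Φ L).symm
    · simp only [Gen.top, Gen.bot, Nat.add_comm 2 k]
      rcases L with _ | ⟨⟨a, x⟩, _ | ⟨⟨c, y⟩, L⟩⟩
      · rfl
      · rfl
      · simp only [actAt, Gen.act]
        -- A crossing acts by a sum of four terms; linearity of the action of `h` is applied to them
        -- two at a time, with coefficients `1` for the outer sums.
        have H := fun α β => actAt_linear s h k α β
        rw [← H, ← one_mul (actAt s h k _ L), ← H, ← one_mul (actAt s h k _ L), ← H]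
        simp only [one_mul]
  | succ i ih =>
    have := ih.shiftRight s (by simp)
    simpa only [shiftRight, List.map_cons, List.map_nil, Nat.add_right_comm _ 1] using this

theorem actEq_straightenLeft (i : ℕ) (b : Bool) :
    ActEq s [(i + 1, .cup b), (i, .cap)] [] := by
  induction i with
  | zero =>
    rintro Φ (_ | ⟨⟨a, x⟩, L⟩) t t' h h'
    · simp [run_cons, step] at h
    · simp [run_cons, step] at h
      revert h
      cases a <;> cases b <;> cases x <;>
        simp [actAt, Gen.act, cupWeight, capWeight, ← mul_assoc]
  | succ i ih => exact ih.shiftRight s (by simp)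

theorem actEq_straightenRight (i : ℕ) (b : Bool) :
    ActEq s [(i, .cup b), (i + 1, .cap)] [] := by
  induction i with
  | zero =>
    rintro Φ (_ | ⟨⟨a, x⟩, L⟩) t t' h h'
    · simp [run_cons, step] at h
    · simp [run_cons, step] at h
      revert h
      cases a <;> cases b <;> cases x <;>
        simp [actAt, Gen.act, cupWeight, capWeight, ← mul_assoc]
  | succ i ih => exact ih.shiftRight s (by simp)

/-- The crossing weights are normalised so that a curl contributes the factor `1`; no correction by
the writhe is needed. -/
theorem actEq_reidemeister1Cap (i : ℕ) (e : Bool) :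
    ActEq s [(i, .cross e), (i, .cap)] [(i, .cap)] := by
  induction i with
  | zero =>
    rintro Φ (_ | ⟨⟨a, x⟩, _ | ⟨⟨c, y⟩, L⟩⟩) t t' h h'
    · simp [run_cons, step] at h
    · simp [run_cons, step] at h
    · have hs := s.mul_inv
      simp [run_cons, step] at h'
      revert h'
      cases a <;> cases c <;> cases x <;> cases y <;> cases e <;>
        simp [actAt, Gen.act, crossWeight, capWeight] <;> grind
  | succ i ih => exact ih.shiftRight s (by simp)

theorem actEq_reidemeister1Cup (i : ℕ) (b e : Bool) :
    ActEq s [(i, .cup b), (i, .cross e)] [(i, .cup (!b))] := by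
  induction i with
  | zero =>
    rintro Φ L t t' - -
    have hs := s.mul_inv
    cases b <;> cases e <;> simp [actAt, Gen.act, crossWeight, cupWeight] <;> grind
  | succ i ih => exact ih.shiftRight s (by simp)

theorem actEq_reidemeister2 (i : ℕ) (e : Bool) :
    ActEq s [(i, .cross e), (i, .cross (!e))] [] := by
  induction i with
  | zero =>
    rintro Φ (_ | ⟨⟨a, x⟩, _ | ⟨⟨c, y⟩, L⟩⟩) t t' h h'
    · simp [run_cons, step] at h
    · simp [run_cons, step] at h
    · have hs := s.mul_inv
      clear h h'
      cases a <;> cases c <;> cases x <;> cases y <;> cases e <;>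
        simp [actAt, Gen.act, crossWeight] <;> grind
  | succ i ih => exact ih.shiftRight s (by simp)

theorem actEq_slideCap (i : ℕ) (e : Bool) :
    ActEq s [(i + 1, .cross e), (i, .cap)] [(i, .cross (!e)), (i + 1, .cap)] := by
  induction i with
  | zero =>
    rintro Φ (_ | ⟨⟨a, x⟩, _ | ⟨⟨c, y⟩, _ | ⟨⟨d, w⟩, L⟩⟩⟩) t t' h h'
    · simp [run_cons, step] at h
    · simp [run_cons, step] at h
    · simp [run_cons, step] at h
    · have hs := s.mul_inv
      simp [run_cons, step] at h'
      revert h'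
      cases a <;> cases c <;> cases d <;> cases x <;> cases y <;> cases w <;> cases e <;>
        simp [actAt, Gen.act, crossWeight, capWeight] <;> grind
  | succ i ih => exact ih.shiftRight s (by simp)

theorem actEq_slideCup (i : ℕ) (b e : Bool) :
    ActEq s [(i, .cup b), (i + 1, .cross e)] [(i + 1, .cup b), (i, .cross (!e))] := by
  induction i with
  | zero =>
    rintro Φ (_ | ⟨⟨a, x⟩, L⟩) t t' h h'
    · simp [run_cons, step] at h
    · have hs := s.mul_inv
      clear h h'
      cases a <;> cases b <;> cases x <;> cases e <;>
        simp [actAt, Gen.act, crossWeight, cupWeight] <;> grind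
  | succ i ih => exact ih.shiftRight s (by simp)

set_option maxHeartbeats 4000000 in
theorem actEq_reidemeister3 (i : ℕ) (e : Bool) :
    ActEq s [(i, .cross e), (i + 1, .cross e), (i, .cross e)]
      [(i + 1, .cross e), (i, .cross e), (i + 1, .cross e)] := by
  induction i with
  | zero =>
    rintro Φ (_ | ⟨⟨a, x⟩, _ | ⟨⟨c, y⟩, _ | ⟨⟨d, w⟩, L⟩⟩⟩) t t' h h'
    · simp [run_cons, step] at h
    · simp [run_cons, step] at h
    · simp [run_cons, step] at h
    · have hs := s.mul_inv
      clear h h'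
      cases a <;> cases c <;> cases d <;> cases x <;> cases y <;> cases w <;> cases e <;>
        simp [actAt, Gen.act, crossWeight] <;> grind
  | succ i ih => exact ih.shiftRight s (by simp)

theorem LocalMove.actEq {x y : List Layer} (h : LocalMove x y) : ActEq s x y := by
  cases h with
  | exchange i k g h => exact actEq_exchange s i k g h
  | straightenLeft i b => exact actEq_straightenLeft s i b
  | straightenRight i b => exact actEq_straightenRight s i b
  | reidemeister1Cap i e => exact actEq_reidemeister1Cap s i e
  | reidemeister1Cup i b e => exact actEq_reidemeister1Cup s i b e
  | reidemeister2 i e => exact actEq_reidemeister2 s i e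
  | reidemeister3 i e => exact actEq_reidemeister3 s i e
  | slideCap i e => exact actEq_slideCap s i e
  | slideCup i b e => exact actEq_slideCup s i b e

/-! ### The odd symmetry and the diagram cut open at a minimum -/

/-- The grading factor of a strand. -/
def gradeWeight : Strand → R
  | (true, false) => ↑s⁻¹
  | (true, true) => -↑s⁻¹
  | (false, false) => s
  | (false, true) => -s

/-- The coefficients of the operators which raise (`α`) and lower (`β`) the charge of a strand. -/
def flipWeight (α β : R) : Strand → R
  | (true, false) => α
  | (true, true) => β
  | (false, true) => s * α
  | (false, false) => -(s * β)

/-- The odd symmetry of the state model: a twisted derivation which changes the occupation number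
of one strand. -/
def oddSymmetry (α β : R) : (List Strand → R) → List Strand → R
  | _, [] => 0
  | Φ, p :: L => flipWeight s α β p * Φ ((p.1, !p.2) :: L) +
      gradeWeight s p * oddSymmetry α β (fun M => Φ (p :: M)) L

theorem oddSymmetry_linear (α β x y : R) (Φ Ψ : List Strand → R) (L : List Strand) :
    oddSymmetry s α β (fun M => x * Φ M + y * Ψ M) L =
      x * oddSymmetry s α β Φ L + y * oddSymmetry s α β Ψ L := by
  induction L generalizing Φ Ψ with
  | nil => simp [oddSymmetry]
  | cons p L ih => simp only [oddSymmetry, ih]; ring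

theorem oddSymmetry_smul (α β x : R) (Φ : List Strand → R) (L : List Strand) :
    oddSymmetry s α β (fun M => x * Φ M) L = x * oddSymmetry s α β Φ L := by
  simpa using oddSymmetry_linear s α β x 0 Φ Φ L

theorem oddSymmetry_add (α β : R) (Φ Ψ : List Strand → R) (L : List Strand) :
    oddSymmetry s α β (fun M => Φ M + Ψ M) L =
      oddSymmetry s α β Φ L + oddSymmetry s α β Ψ L := by
  simpa using oddSymmetry_linear s α β 1 1 Φ Ψ L

theorem oddSymmetry_neg (α β : R) (Φ : List Strand → R) (L : List Strand) :
    oddSymmetry s α β (fun M => -Φ M) L = -oddSymmetry s α β Φ L := by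
  simpa using oddSymmetry_smul s α β (-1) Φ L

theorem oddSymmetry_zero (α β : R) (L : List Strand) :
    oddSymmetry s α β (fun _ => 0) L = 0 := by
  simpa using oddSymmetry_smul s α β 0 (fun _ => 0) L

-- The pieces are intertwiners for the odd generators. Occupied upward strands count `+1` and
-- occupied downward ones `-1`; all pieces conserve this charge and the product of the grading
-- factors, so the terms acting further to the right pass through a piece unchanged.
set_option maxHeartbeats 2000000 in
theorem oddSymmetry_actAt (α β : R) (Φ : List Strand → R) (g : Gen) (i : ℕ) (L : List Strand)
    (t : List Bool) (ht : step (dirs L) (i, g) = some t) :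
    oddSymmetry s α β (actAt s g i Φ) L = actAt s g i (oddSymmetry s α β Φ) L := by
  induction i generalizing L t Φ with
  | zero =>
    have hs := s.mul_inv
    rcases g with b | _ | e
    · change oddSymmetry s α β (fun L => _ * Φ _ + _ * Φ _) L = _
      rw [oddSymmetry_linear s α β _ _ (fun L => Φ (_ :: _ :: L)) (fun L => Φ (_ :: _ :: L))]
      cases b <;> simp [actAt, Gen.act, oddSymmetry, cupWeight, gradeWeight, flipWeight] <;> grind
    · rcases L with _ | ⟨⟨a, x⟩, _ | ⟨⟨c, y⟩, L⟩⟩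
      · simp [step] at ht
      · simp [step] at ht
      · simp [step] at ht
        replace ht := ht.1
        revert ht
        cases a <;> cases c <;> cases x <;> cases y <;>
          simp [actAt, Gen.act, oddSymmetry, capWeight, gradeWeight, flipWeight,
            oddSymmetry_smul, oddSymmetry_neg, oddSymmetry_zero] <;> grind
    · rcases L with _ | ⟨⟨a, x⟩, _ | ⟨⟨c, y⟩, L⟩⟩
      · simp [step] at ht
      · simp [step] at ht
      · clear ht
        cases e <;> cases a <;> cases c <;> cases x <;> cases y <;>
          simp [actAt, Gen.act, oddSymmetry, crossWeight, gradeWeight, flipWeight,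
            oddSymmetry_smul, oddSymmetry_add, oddSymmetry_neg] <;> grind
  | succ i ih =>
    cases L with
    | nil => simp [actAt, oddSymmetry]
    | cons p L =>
      simp only [List.map_cons, step_succ] at ht
      obtain ⟨t', ht', -⟩ := Option.map_eq_some_iff.1 ht
      simp only [actAt, oddSymmetry]
      rw [actAt_linear s g i _ _ (fun M => Φ ((p.1, !p.2) :: M)), ← ih _ L t' ht']

/-- The value of a stack of layers on a state below it, no strand being left open at the top. -/
def eval (D : List Layer) : List Strand → R := actList s D fun L => if L = [] then 1 else 0

/-- The symmetry can be pushed to the top of the diagram, where the only state is empty and the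
symmetry vanishes by definition. -/
theorem oddSymmetry_eval (α β : R) (D : List Layer) (L : List Strand)
    (h : run (dirs L) D = some []) : oddSymmetry s α β (eval s D) L = 0 := by
  induction D generalizing L with
  | nil =>
    have : L = [] := by simpa using h
    subst this
    rfl
  | cons x D ih =>
    rw [run_cons] at h
    obtain ⟨t, ht, h'⟩ := Option.bind_eq_some_iff.1 h
    have key := oddSymmetry_actAt s α β (eval s D) x.2 x.1 L t ht
    change oddSymmetry s α β (actAt s x.2 x.1 (eval s D)) L = 0
    -- The zero function is written as a linear combination so that `actAt_linear` shows that its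
    -- image is zero.
    rw [key, actAt_congr s (Ψ := fun _ => 0 * 0 + 0 * 0) ht fun M hM => by
      rw [ih M (by rw [hM]; exact h')]; simp]
    rw [actAt_linear s x.2 x.1 0 0 (fun _ => 0) (fun _ => 0)]
    simp

/-- The normalising factor of a minimum at which a diagram is cut open. -/
def cutWeight : Bool → R
  | true => s
  | false => 1

/-- The state sum of a diagram which is cut open at its first minimum. -/
def stateSum : List Layer → R
  | (_, .cup b) :: D => cutWeight s b * eval s D [(b, false), (!b, false)]
  | _ => 0

/-- Exchanging the two lowest minima changes the one that is cut. In each case one raising and one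
lowering relation share a state in which the two occupied strands belong to different minima;
eliminating it leaves exactly the required relation between the two sums. -/
theorem stateSum_cut_comm (b b' : Bool) (D : List Layer)
    (h : run [b, !b, b', !b'] D = some []) :
    stateSum s ([(0, .cup b), (2, .cup b')] ++ D) =
      stateSum s ([(0, .cup b'), (0, .cup b)] ++ D) := by
  have hs := s.mul_inv
  have H : ∀ α β x y x' y', oddSymmetry s α β (eval s D) [(b, x), (!b, y), (b', x'), (!b', y')] = 0 :=
    fun α β x y x' y' => oddSymmetry_eval s α β D _ (by simpa using h)
  change cutWeight s b * (actAt s (.cup b') 2 (eval s D) _) =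
    cutWeight s b' * (actAt s (.cup b) 0 (eval s D) _)
  cases b <;> cases b'
  · have h1 := H 1 0 false false true false
    have h2 := H 0 1 false true false false
    simp [actAt, Gen.act, oddSymmetry, cupWeight, cutWeight, gradeWeight, flipWeight] at h1 h2 ⊢
    grind
  · have h1 := H 1 0 true false false false
    have h2 := H 0 1 false false true false
    simp [actAt, Gen.act, oddSymmetry, cupWeight, cutWeight, gradeWeight, flipWeight] at h1 h2 ⊢
    grind
  · have h1 := H 1 0 false false true false
    have h2 := H 0 1 true false false false
    simp [actAt, Gen.act, oddSymmetry, cupWeight, cutWeight, gradeWeight, flipWeight] at h1 h2 ⊢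
    grind
  · have h1 := H 1 0 false false false true
    have h2 := H 0 1 true false false false
    simp [actAt, Gen.act, oddSymmetry, cupWeight, cutWeight, gradeWeight, flipWeight] at h1 h2 ⊢
    grind

theorem eval_congr {x y : List Layer} (h : ActEq s x y) (A B : List Layer) (L : List Strand)
    {t t' : List Bool} (hx : run (dirs L) (A ++ x ++ B) = some t)
    (hy : run (dirs L) (A ++ y ++ B) = some t') :
    eval s (A ++ x ++ B) L = eval s (A ++ y ++ B) L := by
  simp only [eval, List.append_assoc, actList_append] at hx hy ⊢
  rw [run_append] at hx hy
  obtain ⟨u, hu, hx⟩ := Option.bind_eq_some_iff.1 hx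
  rw [hu, Option.bind_some] at hy
  refine actList_congr s hu fun M hM => ?_
  subst hM
  rw [run_append] at hx hy
  obtain ⟨v, hv, -⟩ := Option.bind_eq_some_iff.1 hx
  obtain ⟨v', hv', -⟩ := Option.bind_eq_some_iff.1 hy
  exact h _ M v v' hv hv'

/-- The first layer of a diagram is a minimum. -/
theorem step_nil_eq_some {x : Layer} {t : List Bool} (h : step [] x = some t) :
    ∃ b, x = (0, .cup b) ∧ t = [b, !b] := by
  obtain ⟨i, _ | _ | _⟩ := x <;> simp [step] at h
  exact ⟨_, by rw [h.1], by simp [← h.2]⟩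

theorem run_nil_cons {x : Layer} {D : List Layer} {t : List Bool}
    (h : run [] (x :: D) = some t) :
    ∃ b, x = (0, .cup b) ∧ run [b, !b] D = some t := by
  rw [run_cons] at h
  obtain ⟨u, hu, h⟩ := Option.bind_eq_some_iff.1 h
  obtain ⟨b, rfl, rfl⟩ := step_nil_eq_some hu
  exact ⟨b, rfl, h⟩

theorem stateSum_cup (i : ℕ) (b : Bool) (D : List Layer) :
    stateSum s ((i, .cup b) :: D) = cutWeight s b * eval s D [(b, false), (!b, false)] := rfl

theorem eval_cons (x : Layer) (D : List Layer) : eval s (x :: D) = actAt s x.2 x.1 (eval s D) := rfl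

/-- `actEq_reidemeister1Cup` does not apply, since the cut minimum is not summed over. The odd
symmetry expresses the value with both strands occupied by the value with both empty. -/
theorem stateSum_curl (b e : Bool) (B : List Layer) (h : run [!b, b] B = some []) :
    stateSum s ((0, .cup b) :: (0, .cross e) :: B) = stateSum s ((0, .cup (!b)) :: B) := by
  have hs := s.mul_inv
  have H : ∀ α β x y, oddSymmetry s α β (eval s B) [(!b, x), (b, y)] = 0 :=
    fun α β x y => oddSymmetry_eval s α β B _ (by simpa using h)
  rw [stateSum_cup, stateSum_cup, eval_cons]
  cases b
  · have h1 := H 1 0 false true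
    cases e <;>
    simp [actAt, Gen.act, oddSymmetry, crossWeight, cutWeight, gradeWeight, flipWeight] at h1 ⊢
    all_goals grind
  · have h1 := H 1 0 true false
    cases e <;>
    simp [actAt, Gen.act, oddSymmetry, crossWeight, cutWeight, gradeWeight, flipWeight] at h1 ⊢
    all_goals grind

/-- No strand is present below the first layer, so the only moves which can involve it are the
exchange of two minima and a curl at the minimum. -/
theorem stateSum_localMove_bottom {x y B : List Layer} (h : LocalMove x y)
    (hx : IsLinkDiagram (x ++ B)) (hy : IsLinkDiagram (y ++ B)) :
    stateSum s (x ++ B) = stateSum s (y ++ B) := by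
  unfold IsLinkDiagram at hx hy
  cases h with
  | exchange i k g h =>
    obtain ⟨b, hb, hx⟩ := run_nil_cons hx
    obtain ⟨b', hb', hy⟩ := run_nil_cons hy
    obtain ⟨rfl, rfl⟩ := Prod.mk.inj hb
    obtain ⟨hk, rfl⟩ := Prod.mk.inj hb'
    obtain rfl : k = 0 := by omega
    refine stateSum_cut_comm s b b' B ?_
    simpa [run_cons, step, Gen.bot] using hy
  | reidemeister1Cup i b e =>
    obtain ⟨b', hb, hx⟩ := run_nil_cons hx
    obtain ⟨rfl, hb⟩ := Prod.mk.inj hb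
    obtain rfl : b = b' := by simpa using hb
    refine stateSum_curl s b e B ?_
    simpa [run_cons, step] using hx
  | straightenLeft i b => obtain ⟨_, h, -⟩ := run_nil_cons hx; simp at h
  | straightenRight i b =>
    obtain ⟨_, h, hx⟩ := run_nil_cons hx
    obtain ⟨rfl, -⟩ := Prod.mk.inj h
    simp [run_cons, step] at hx
  | reidemeister1Cap i e => obtain ⟨_, h, -⟩ := run_nil_cons hx; simp at h
  | reidemeister2 i e => obtain ⟨_, h, -⟩ := run_nil_cons hx; simp at h
  | reidemeister3 i e => obtain ⟨_, h, -⟩ := run_nil_cons hx; simp at h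
  | slideCap i e => obtain ⟨_, h, -⟩ := run_nil_cons hx; simp at h
  | slideCup i b e => obtain ⟨_, h, -⟩ := run_nil_cons hy; simp at h

theorem stateSum_move {D E : List Layer} (h : Move D E) : stateSum s D = stateSum s E := by
  obtain ⟨A, B, x, y, h, hx, hy⟩ := h
  cases A with
  | nil => exact stateSum_localMove_bottom s h hx hy
  | cons a A =>
    obtain ⟨b, rfl, hx'⟩ := run_nil_cons hx
    obtain ⟨b', hb, hy'⟩ := run_nil_cons hy
    obtain rfl : b = b' := by simpa using hb
    exact congrArg (cutWeight s b * ·)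
      (eval_congr s (h.actEq s) A B _ (by simpa using hx') (by simpa using hy'))

theorem stateSum_isotopic {D E : List Layer} (h : Isotopic D E) :
    stateSum s D = stateSum s E := by
  induction h with
  | rel _ _ h => exact stateSum_move s h
  | refl => rfl
  | symm _ _ _ ih => exact ih.symm
  | trans _ _ _ _ _ ih ih' => exact ih.trans ih'

/-! ### The skein relation of the state sum and uniqueness of the Alexander polynomial -/

theorem act_cross_sub (a c x y : Bool) (Φ : List Strand → R) (L : List Strand) :
    actList s [(0, .cross (a == c))] Φ ((a, x) :: (c, y) :: L) =
      1 * actList s [(0, .cross (!(a == c)))] Φ ((a, x) :: (c, y) :: L) +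
      (s - ↑s⁻¹) * actList s (smoothing 0 a c) Φ ((a, x) :: (c, y) :: L) := by
  have hs := s.mul_inv
  cases a <;> cases c <;> cases x <;> cases y <;>
    simp [smoothing, actAt, Gen.act, crossWeight, cupWeight, capWeight] <;> grind

theorem smoothing_succ (i : ℕ) (a c : Bool) :
    smoothing (i + 1) a c = shiftRight (smoothing i a c) := by
  unfold smoothing; split_ifs <;> rfl

theorem actList_skein (u : List Bool) (a c : Bool) (v : List Bool) (Φ : List Strand → R)
    (L : List Strand) (hL : dirs L = u ++ a :: c :: v) :
    actList s [(u.length, .cross (a == c))] Φ L =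
      1 * actList s [(u.length, .cross (!(a == c)))] Φ L +
      (s - ↑s⁻¹) * actList s (smoothing u.length a c) Φ L := by
  induction u generalizing L Φ with
  | nil =>
    rcases L with _ | ⟨⟨a, x⟩, _ | ⟨⟨c, y⟩, L⟩⟩ <;> simp at hL
    obtain ⟨rfl, rfl, -⟩ := hL
    exact act_cross_sub s _ _ x y Φ L
  | cons b u ih =>
    rcases L with _ | ⟨p, L⟩ <;> simp at hL
    have := ih (fun M => Φ (p :: M)) L (by simpa using hL.2)
    rw [← actList_shiftRight, ← actList_shiftRight, ← actList_shiftRight,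
      ← smoothing_succ] at this
    exact this

theorem actList_linear (D : List Layer) (α β : R) (Φ Ψ : List Strand → R) (L : List Strand) :
    actList s D (fun M => α * Φ M + β * Ψ M) L = α * actList s D Φ L + β * actList s D Ψ L := by
  induction D generalizing L with
  | nil => rfl
  | cons x D ih =>
    simp only [actList_cons, funext ih]
    exact actAt_linear s x.2 x.1 α β _ _ L

theorem stateSum_skein {P N Z : List Layer} (h : SkeinTriple P N Z) :
    stateSum s P = stateSum s N + (s - ↑s⁻¹) * stateSum s Z := by
  obtain ⟨A, B, u, v, a, c, hA, -⟩ := h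
  cases A with
  | nil => simp at hA
  | cons x A =>
    obtain ⟨b, rfl, hA'⟩ := run_nil_cons hA
    have key : eval s (A ++ [(u.length, .cross (a == c))] ++ B) [(b, false), (!b, false)] =
        1 * eval s (A ++ [(u.length, .cross (!(a == c)))] ++ B) [(b, false), (!b, false)] +
        (s - ↑s⁻¹) * eval s (A ++ smoothing u.length a c ++ B) [(b, false), (!b, false)] := by
      simp only [eval, List.append_assoc, actList_append]
      rw [← actList_linear]
      exact actList_congr s (t := u ++ a :: c :: v) (by simpa using hA') fun M hM =>
        actList_skein s u a c v _ M hM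
    change cutWeight s b * eval s (A ++ _ ++ B) _ = cutWeight s b * eval s (A ++ _ ++ B) _ +
      _ * (cutWeight s b * eval s (A ++ _ ++ B) _)
    rw [key]
    ring

end StateModel

open LaurentPolynomial

/-- The variable `√t` as a unit of the ring of Laurent polynomials. -/
noncomputable def sqrtT : (ℤ[T;T⁻¹])ˣ where
  val := T 1
  inv := T (-1)
  val_inv := by rw [← T_add]; simp
  inv_val := by rw [← T_add]; simp

/-- Every derivation computes the same independently defined invariant, so two derivations cannot
disagree. -/
theorem SkeinValue.eq_stateSum {D : List Layer} {p : ℤ[T;T⁻¹]} (h : SkeinValue D p) :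
    p = stateSum sqrtT D := by
  have hz : (sqrtT : ℤ[T;T⁻¹]) - ((sqrtT⁻¹ : (ℤ[T;T⁻¹])ˣ) : ℤ[T;T⁻¹]) = T 1 - T (-1) := rfl
  induction h with
  | unknot =>
    simp [HopfPlumbing.unknot, stateSum, eval, actAt, Gen.act, capWeight, cutWeight]
  | isotopic h _ ih => rw [ih, stateSum_isotopic _ h]
  | positive h _ _ ih ih' => rw [ih, ih', stateSum_skein _ h, hz]
  | negative h _ _ ih ih' => rw [ih, ih', stateSum_skein _ h, hz]; ring
  | smoothed h _ _ hz' ih ih' =>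
    rw [ih, ih', stateSum_skein _ h, hz, add_right_inj] at hz'
    -- Recovering the smoothed term requires cancelling $\sqrt t-1/\sqrt t$, which is non-zero
    -- because its two monomials have different degrees.
    refine (mul_left_cancel₀ ?_ hz').symm
    intro h0
    have := congrArg LaurentPolynomial.degree (sub_eq_zero.1 h0)
    rw [degree_T, degree_T] at this
    exact absurd this (by decide)

/-- The Alexander polynomial is determined by the skein relation. -/
theorem SkeinValue.isAlexanderPolynomial {D : List Layer} {p : ℤ[T;T⁻¹]} (h : SkeinValue D p) :
    IsAlexanderPolynomial D p :=
  fun _ => ⟨fun hx => hx.eq_stateSum.trans h.eq_stateSum.symm, fun hx => hx ▸ h⟩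

/-! ### Isotopy of tangles inside link diagrams -/

/-- Isotopy of tangle diagrams with the directions `st` at the bottom and `t` at the top. -/
def TangleIsotopic (st t : List Bool) : List Layer → List Layer → Prop :=
  Relation.EqvGen fun x y => ∃ A B x₀ y₀, LocalMove x₀ y₀ ∧ x = A ++ x₀ ++ B ∧ y = A ++ y₀ ++ B ∧
    run st x = some t ∧ run st y = some t

theorem run_context {st t st' t' : List Bool} {x A B : List Layer} (hA : run st' A = some st)
    (hx : run st x = some t) (hB : run t B = some t') : run st' (A ++ x ++ B) = some t' := by
  rw [run_append, run_append, hA, Option.bind_some, hx, Option.bind_some, hB]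

namespace TangleIsotopic

variable {st t r st' t' : List Bool} {x y z A B : List Layer}

theorem refl (x : List Layer) : TangleIsotopic st t x x := Relation.EqvGen.refl x

theorem symm (h : TangleIsotopic st t x y) : TangleIsotopic st t y x := Relation.EqvGen.symm _ _ h

theorem trans (h : TangleIsotopic st t x y) (h' : TangleIsotopic st t y z) :
    TangleIsotopic st t x z := Relation.EqvGen.trans _ _ _ h h'

theorem move (A B : List Layer) (h : LocalMove x y) (hx : run st (A ++ x ++ B) = some t)
    (hy : run st (A ++ y ++ B) = some t) : TangleIsotopic st t (A ++ x ++ B) (A ++ y ++ B) :=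
  .rel _ _ ⟨A, B, x, y, h, rfl, rfl, hx, hy⟩

theorem context (h : TangleIsotopic st t x y) (hA : run st' A = some st)
    (hB : run t B = some t') : TangleIsotopic st' t' (A ++ x ++ B) (A ++ y ++ B) := by
  induction h with
  | rel _ _ h =>
    obtain ⟨C, D, x, y, h, rfl, rfl, hx, hy⟩ := h
    have := move (st := st') (t := t') (A ++ C) (D ++ B) h
      (by simpa using run_context hA hx hB) (by simpa using run_context hA hy hB)
    simpa using this
  | refl => exact refl _
  | symm _ _ _ ih => exact ih.symm
  | trans _ _ _ _ _ ih ih' => exact ih.trans ih'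

end TangleIsotopic

theorem step_append_right {st t : List Bool} {x : Layer} (r : List Bool)
    (h : step st x = some t) : step (st ++ r) x = some (t ++ r) := by
  obtain ⟨i, g⟩ := x
  induction i generalizing st t with
  | zero =>
    rcases g with b | _ | e
    · simp [step] at h ⊢
      simp [← h]
    · rcases st with _ | ⟨a, _ | ⟨c, v⟩⟩ <;> simp [step] at h ⊢
      exact ⟨h.1, by rw [h.2]⟩
    · rcases st with _ | ⟨a, _ | ⟨c, v⟩⟩ <;> simp [step] at h ⊢
      simp [← h]
  | succ i ih =>
    cases st with
    | nil => simp [step_nil_succ] at h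
    | cons a st =>
      rw [step_succ] at h
      obtain ⟨u, hu, rfl⟩ := Option.map_eq_some_iff.1 h
      rw [List.cons_append, step_succ, ih hu]
      rfl

theorem run_append_right {st t : List Bool} {D : List Layer} (r : List Bool)
    (h : run st D = some t) : run (st ++ r) D = some (t ++ r) := by
  induction D generalizing st with
  | nil => simpa using h
  | cons x D ih =>
    rw [run_cons] at h ⊢
    obtain ⟨u, hu, h⟩ := Option.bind_eq_some_iff.1 h
    rw [step_append_right r hu]
    exact ih h

theorem TangleIsotopic.append_right {st t : List Bool} {x y : List Layer} (r : List Bool)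
    (h : TangleIsotopic st t x y) : TangleIsotopic (st ++ r) (t ++ r) x y := by
  refine h.mono fun x y => ?_
  rintro ⟨C, D, x, y, h, rfl, rfl, hx, hy⟩
  exact ⟨C, D, x, y, h, rfl, rfl, run_append_right r hx, run_append_right r hy⟩

theorem TangleIsotopic.isotopic {x y : List Layer} (h : TangleIsotopic [] [] x y) :
    Isotopic x y := by
  refine h.mono fun x y => ?_
  rintro ⟨C, D, x, y, h, rfl, rfl, hx, hy⟩
  exact ⟨C, D, x, y, h, hx, hy⟩

/-- Replacing a tangle inside a link diagram by an isotopic one. -/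
theorem SkeinValue.replace {st t r : List Bool} {x y A B : List Layer} {p : ℤ[T;T⁻¹]}
    (h : SkeinValue (A ++ x ++ B) p) (hxy : TangleIsotopic st t x y)
    (hA : run [] A = some (st ++ r)) (hB : run (t ++ r) B = some []) :
    SkeinValue (A ++ y ++ B) p :=
  .isotopic ((hxy.append_right r).context hA hB).isotopic h

section Tangles

open TangleIsotopic

/-- A crossing inserted between the minimum and the maximum can be removed from below, reversing the
circle, or from above, keeping it. -/
theorem circle_flip (st : List Bool) (i : ℕ) (hi : i ≤ st.length) (b : Bool) :
    TangleIsotopic st st [(i, .cup b), (i, .cap)] [(i, .cup (!b)), (i, .cap)] := by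
  have h : ∀ b, run st [(i, .cup b), (i, .cap)] = some st := fun b => by
    simp [run_cons, step, hi]
  have h' : run st [(i, .cup b), (i, .cross true), (i, .cap)] = some st := by
    simp [run_cons, step, hi]
  exact (move [(i, .cup b)] [] (.reidemeister1Cap i true) h' (h b)).symm.trans
    (move [] [(i, .cap)] (.reidemeister1Cup i b true) h' (h _))

theorem LocalMove.slideCup_not (i : ℕ) (b e : Bool) :
    LocalMove [(i, .cup b), (i + 1, .cross (!e))] [(i + 1, .cup b), (i, .cross e)] := by
  simpa using LocalMove.slideCup i b (!e)

theorem LocalMove.slideCap_not (i : ℕ) (e : Bool) :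
    LocalMove [(i + 1, .cross (!e)), (i, .cap)] [(i, .cross e), (i + 1, .cap)] := by
  simpa using LocalMove.slideCap i (!e)

theorem LocalMove.reidemeister2_not (i : ℕ) (e : Bool) :
    LocalMove [(i, .cross (!e)), (i, .cross e)] [] := by
  simpa using LocalMove.reidemeister2 i (!e)

/-! ### Half twists of three strands -/

/-- The half twist of three strands. -/
def halfTwist (o : Bool) : List Layer := [(1, .cross o), (0, .cross o), (1, .cross o)]

/-- Moving the minimum up and the maximum down brings them next to the crossing at place `2`. There
the fourth strand is a zigzag with one curl and can be straightened. -/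
theorem bandCrossing_halfTwist (o : Bool) :
    TangleIsotopic [false, true, false] [false, true, false] (bandCrossing o) (halfTwist o) :=
  (move [] [(0, .cross o), (2, .cross o), (1, .cross o), (3, .cap)]
    (.exchange 1 0 (.cross o) (.cup true)) rfl rfl).symm.trans <|
  (move [(1, .cross o)] [(2, .cross o), (1, .cross o), (3, .cap)]
    (.exchange 0 1 (.cross o) (.cup true)) rfl rfl).symm.trans <|
  (move [(1, .cross o), (0, .cross o), (3, .cup true), (2, .cross o)] []
    (.exchange 1 0 (.cross o) .cap) rfl rfl).trans <|
  (move [(1, .cross o), (0, .cross o)] [(3, .cap), (1, .cross o)]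
    (.slideCup_not 2 true o) rfl rfl).symm.trans <|
  (move [(1, .cross o), (0, .cross o), (2, .cup true)] [(1, .cross o)]
    (.reidemeister1Cap 3 (!o)) rfl rfl).trans <|
  (move [(1, .cross o), (0, .cross o)] [(1, .cross o)] (.straightenRight 2 true) rfl rfl)

theorem halfTwist_cancel (o : Bool) :
    TangleIsotopic [false, true, false] [false, true, false] (halfTwist o ++ halfTwist (!o)) [] :=
  (move [(1, .cross o), (0, .cross o)] [(0, .cross (!o)), (1, .cross (!o))]
    (.reidemeister2 1 o) rfl rfl).trans <|
  (move [(1, .cross o)] [(1, .cross (!o))] (.reidemeister2 0 o) rfl rfl).trans <|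
  (move [] [] (.reidemeister2 1 o) rfl rfl)

/-- The minimum which is created at the place `0` (for `j = false`) or `1` (for `j = true`) next to
a strand pointing downwards. -/
def cupAt (j : Bool) : Layer := (j.toNat, .cup j)

/-- The maximum at the place `0` (for `j = false`) or `1` (for `j = true`). -/
def capAt (j : Bool) : Layer := (j.toNat, .cap)

theorem cupAt_two_crossings (o : Bool) : TangleIsotopic [false] [false, true, false]
    [(1, .cup false), (0, .cross o), (1, .cross o)] [cupAt false] :=
  (move [] [(1, .cross o)] (.slideCup_not 0 false o) rfl rfl).symm.trans <|
  move [(0, .cup false)] [] (.reidemeister2_not 1 o) rfl rfl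

/-- A half twist reverses the order of the three strands, so a minimum on one side emerges on the
other. The result does not involve `o`: this is why cut words forget the order of the bands. -/
theorem cupAt_halfTwist (j o : Bool) : TangleIsotopic [false] [false, true, false]
    (cupAt j :: halfTwist o) [cupAt (!j)] := by
  cases j
  · exact (move [] [(0, .cross o), (1, .cross o)] (.slideCup 0 false o) rfl rfl).trans <|
      (move [(1, .cup false)] [(1, .cross o)] (.reidemeister2_not 0 o) rfl rfl).trans <|
      move [] [] (.reidemeister1Cup 1 false o) rfl rfl
  · exact (move [] [(0, .cross o), (1, .cross o)] (.reidemeister1Cup 1 true o) rfl rfl).trans <|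
      cupAt_two_crossings o

theorem two_crossings_capAt (o : Bool) : TangleIsotopic [false, true, false] [false]
    [(1, .cross o), (0, .cross o), (1, .cap)] [capAt false] :=
  (move [(1, .cross o)] [] (.slideCap_not 0 o) rfl rfl).symm.trans <|
  move [] [(0, .cap)] (.reidemeister2 1 o) rfl rfl

theorem halfTwist_capAt (j o : Bool) : TangleIsotopic [false, true, false] [false]
    (halfTwist o ++ [capAt j]) [capAt (!j)] := by
  cases j
  · exact (move [(1, .cross o), (0, .cross o)] [] (.slideCap 0 o) rfl rfl).trans <|
      (move [(1, .cross o)] [(1, .cap)] (.reidemeister2 0 o) rfl rfl).trans <|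
      move [] [] (.reidemeister1Cap 1 o) rfl rfl
  · exact (move [(1, .cross o), (0, .cross o)] [] (.reidemeister1Cap 1 o) rfl rfl).trans <|
      two_crossings_capAt o

end Tangles

open TangleIsotopic

/-! ### Curls and split circles -/

theorem take_length_succ {α : Type*} (u : List α) : u.take (u.length + 1) = u :=
  List.take_of_length_le (Nat.le_succ _)

theorem drop_length_succ {α : Type*} (u : List α) : u.drop (u.length + 1) = [] :=
  List.drop_eq_nil_of_le (Nat.le_succ _)

/-- A curl on the right of a strand. -/
theorem curl_right (u v : List Bool) (a e : Bool) :
    TangleIsotopic (u ++ a :: v) (u ++ a :: v)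
      [(u.length + 1, .cup a), (u.length, .cross e), (u.length + 1, .cap)] [] := by
  refine (move [] [(u.length + 1, .cap)] (.slideCup_not u.length a e) ?_ ?_).symm.trans <|
    (move [(u.length, .cup a)] [] (.reidemeister1Cap (u.length + 1) (!e)) ?_ ?_).trans <|
    (move [] [] (.straightenRight u.length a) ?_ rfl)
  all_goals cases a <;> simp [run_cons, step, List.take_append, List.drop_append,
      take_length_succ, drop_length_succ]

/-- A curl on the left of a strand. -/
theorem curl_left (u v : List Bool) (a e : Bool) :
    TangleIsotopic (u ++ a :: v) (u ++ a :: v)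
      [(u.length, .cup (!a)), (u.length + 1, .cross e), (u.length, .cap)] [] := by
  refine (move [(u.length, .cup (!a))] [] (.slideCap u.length e) ?_ ?_).trans <|
    (move [] [(u.length + 1, .cap)] (.reidemeister1Cup u.length (!a) (!e)) ?_ ?_).trans <|
    (move [] [] (.straightenRight u.length (!!a)) ?_ rfl)
  all_goals cases a <;> simp [run_cons, step, List.take_append, List.drop_append,
      take_length_succ, drop_length_succ]

theorem SkeinValue.congr {st t r : List Bool} {x y A B : List Layer} {p : ℤ[T;T⁻¹]}
    (h : SkeinValue (A ++ y ++ B) p) (hxy : TangleIsotopic st t x y)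
    (hA : run [] A = some (st ++ r)) (hB : run (t ++ r) B = some []) :
    SkeinValue (A ++ x ++ B) p :=
  h.replace hxy.symm hA hB

/-- A diagram with an additional circle on the right of a strand has the value `0`. -/
theorem SkeinValue.circle_right {A B : List Layer} {u v : List Bool} {a : Bool} {p : ℤ[T;T⁻¹]}
    (h : SkeinValue (A ++ B) p) (hA : run [] A = some (u ++ a :: v))
    (hB : run (u ++ a :: v) B = some []) (b : Bool) :
    SkeinValue (A ++ [(u.length + 1, .cup b), (u.length + 1, .cap)] ++ B) 0 := by
  have key : SkeinValue (A ++ [(u.length + 1, .cup a), (u.length + 1, .cap)] ++ B) 0 := by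
    have hc : ∀ e, SkeinValue (A ++ [(u.length + 1, .cup a), (u.length, .cross e),
        (u.length + 1, .cap)] ++ B) p := fun e =>
      SkeinValue.congr (r := []) (y := []) (by simpa using h) (curl_right u v a e)
        (by simpa using hA) (by simpa using hB)
    have hs : run (u ++ a :: v) [(u.length + 1, .cup a)] = some (u ++ a :: a :: (!a) :: v) := by
      simp [run_cons, step, List.take_append, List.drop_append,
      take_length_succ, drop_length_succ]
    have ht : run (u ++ a :: a :: (!a) :: v) [(u.length, .cross true), (u.length + 1, .cap)] =
        some (u ++ a :: v) := by
      simp [run_cons, step, List.take_append, List.drop_append,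
      take_length_succ, drop_length_succ]
    have tr := SkeinTriple.mk (A ++ [(u.length + 1, .cup a)]) ([(u.length + 1, .cap)] ++ B) u
      ((!a) :: v) a a (by rw [run_append, hA]; exact hs) (by
        have := run_context (run_context (B := []) hA hs rfl) ht hB
        simpa [IsLinkDiagram] using this)
    -- Both signs of the curl give `p`, and smoothing its crossing gives the circle, so $p=p+(\sqrt
    -- t-1/\sqrt t)\cdot 0$ yields the value `0`.
    simpa [smoothing] using SkeinValue.smoothed (p := p) (n := p) (z := 0) tr
      (by simpa using hc true) (by simpa using hc false) (by simp)
  obtain rfl | rfl : b = a ∨ b = !a := by cases a <;> cases b <;> simp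
  · exact key
  · exact key.replace (r := []) (circle_flip (u ++ a :: v) (u.length + 1) (by simp) a)
      (by simpa using hA) (by simpa using hB)

/-- A diagram with an additional circle on the left of a strand has the value `0`. -/
theorem SkeinValue.circle_left {A B : List Layer} {u v : List Bool} {a : Bool} {p : ℤ[T;T⁻¹]}
    (h : SkeinValue (A ++ B) p) (hA : run [] A = some (u ++ a :: v))
    (hB : run (u ++ a :: v) B = some []) (b : Bool) :
    SkeinValue (A ++ [(u.length, .cup b), (u.length, .cap)] ++ B) 0 := by
  have key : SkeinValue (A ++ [(u.length, .cup (!a)), (u.length, .cap)] ++ B) 0 := by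
    have hc : ∀ e, SkeinValue (A ++ [(u.length, .cup (!a)), (u.length + 1, .cross e),
        (u.length, .cap)] ++ B) p := fun e =>
      SkeinValue.congr (r := []) (y := []) (by simpa using h) (curl_left u v a e)
        (by simpa using hA) (by simpa using hB)
    have hs : run (u ++ a :: v) [(u.length, .cup (!a))] = some ((u ++ [!a]) ++ a :: a :: v) := by
      simp [run_cons, step]
    have ht : run ((u ++ [!a]) ++ a :: a :: v) [(u.length + 1, .cross true), (u.length, .cap)] =
        some (u ++ a :: v) := by
      simp [run_cons, step, List.take_append, List.drop_append,
      take_length_succ, drop_length_succ]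
    have tr := SkeinTriple.mk (A ++ [(u.length, .cup (!a))]) ([(u.length, .cap)] ++ B) (u ++ [!a])
      v a a (by rw [run_append, hA]; exact hs) (by
        have := run_context (run_context (B := []) hA hs rfl) ht hB
        simpa [IsLinkDiagram] using this)
    simpa [smoothing] using SkeinValue.smoothed (p := p) (n := p) (z := 0) tr
      (by simpa using hc true) (by simpa using hc false) (by simp)
  obtain rfl | rfl : b = !a ∨ b = !!a := by cases a <;> cases b <;> simp
  · exact key
  · exact key.replace (r := []) (circle_flip (u ++ a :: v) u.length (by simp) (!a))
      (by simpa using hA) (by simpa using hB)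

/-! ### Words, their closures, and the resolution of full twists -/

/-- The pieces of the words whose closures are considered. -/
inductive Letter where
  | twist (pos : Bool)
  | half (o : Bool)
  | cut

/-- The tangle diagram of a letter, with three strands pointing down, up and down. -/
def Letter.layers : Letter → List Layer
  | .twist pos => fullTwist pos
  | .half o => halfTwist o
  | .cut => [capAt false, cupAt false]

/-- The tangle diagram of a word. -/
def word (W : List Letter) : List Layer := W.flatMap Letter.layers

@[simp] theorem word_nil : word [] = [] := rfl

@[simp] theorem word_cons (a : Letter) (W : List Letter) : word (a :: W) = a.layers ++ word W := rfl

@[simp] theorem word_append (V W : List Letter) : word (V ++ W) = word V ++ word W := by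
  simp [word]

theorem run_layers (a : Letter) :
    run [false, true, false] a.layers = some [false, true, false] := by
  cases a <;> rfl

theorem run_word (W : List Letter) :
    run [false, true, false] (word W) = some [false, true, false] := by
  induction W with
  | nil => rfl
  | cons a W ih => rw [word_cons, run_append, run_layers]; exact ih

theorem run_word_right (W : List Letter) (r : List Bool) :
    run (false :: true :: false :: r) (word W) = some (false :: true :: false :: r) :=
  run_append_right r (run_word W)

/-- The three minima below a closed word. -/
def bottomCups : List Layer := [(0, .cup false), (1, .cup true), (2, .cup false)]

/-- The three maxima above a closed word. -/
def topCaps : List Layer := [(2, .cap), (1, .cap), (0, .cap)]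

/-- The link diagram obtained by closing a word on the right. -/
def closure (W : List Letter) : List Layer := bottomCups ++ word W ++ topCaps

theorem run_word_topCaps (W : List Letter) :
    run [false, true, false, true, false, true] (word W ++ topCaps) = some [] := by
  rw [run_append, run_word_right]; rfl

theorem run_bottomCups_word (W : List Letter) :
    run [] (bottomCups ++ word W) = some [false, true, false, true, false, true] := by
  rw [run_append]; exact run_word_right W _

/-- A full twist is resolved into a trivial band and a cut band. -/
theorem SkeinValue.twist {V W : List Letter} {p q : ℤ[T;T⁻¹]} (pos : Bool)
    (hp : SkeinValue (closure (V ++ W)) p) (hq : SkeinValue (closure (V ++ .cut :: W)) q) :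
    SkeinValue (closure (V ++ .twist pos :: W))
      (p + (if pos then T 1 - T (-1) else -(T 1 - T (-1))) * q) := by
  have hA := run_bottomCups_word V
  have hB := run_word_topCaps W
  have h1 : ∀ e, SkeinValue
      (bottomCups ++ word V ++ [(0, .cross e), (0, .cross (!e))] ++ (word W ++ topCaps)) p := by
    intro e
    refine SkeinValue.congr (st := [false, true, false]) (t := [false, true, false])
      (r := [true, false, true]) (y := []) ?_ (move [] [] (.reidemeister2 0 e) rfl rfl) hA hB
    simpa [closure] using hp
  have h2 : ∀ e, SkeinValue
      (bottomCups ++ word V ++ [(0, .cap), (0, .cup true), (0, .cross e)] ++ (word W ++ topCaps))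
      q := by
    intro e
    refine SkeinValue.congr (st := [false, true, false]) (t := [false, true, false])
      (r := [true, false, true]) (y := [capAt false, cupAt false]) ?_
      (move [(0, .cap)] [] (.reidemeister1Cup 0 true e) rfl rfl) hA hB
    simpa [closure, Letter.layers] using hq
  -- The lower crossing is resolved. Switched, it cancels the upper one; smoothed, it turns the
  -- upper one into a curl at the new minimum.
  have tr := fun e => SkeinTriple.mk (bottomCups ++ word V) ([(0, .cross e)] ++ (word W ++ topCaps))
    [] [false, true, false, true] false true hA (by
      have := run_context hA (t := [false, true, false, true, false, true])
        (x := [(0, .cross false), (0, .cross e)]) rfl hB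
      simpa [IsLinkDiagram] using this)
  cases pos
  · have := SkeinValue.negative (tr true) (p := p) (z := q) (by simpa using h1 false)
      (by simpa [smoothing] using h2 true)
    rw [if_neg Bool.false_ne_true, neg_mul, ← sub_eq_add_neg]
    simpa [closure, Letter.layers, fullTwist] using this
  · have := SkeinValue.positive (tr false) (n := p) (z := q) (by simpa using h1 true)
      (by simpa [smoothing] using h2 false)
    simpa [closure, Letter.layers, fullTwist] using this

/-! ### Closures of words with a cut -/

/-- A maximum above the three minima at the bottom. -/
theorem bottomCups_capAt (k : Bool) : TangleIsotopic [] [false, true, false, true]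
    (bottomCups ++ [capAt k]) [cupAt false, cupAt k] := by
  cases k
  · exact (move [(0, .cup false), (1, .cup true)] []
      (.exchange 0 0 .cap (.cup false)) rfl rfl).symm.trans <|
      move [(0, .cup false)] [(0, .cup false)] (.straightenLeft 0 true) rfl rfl
  · exact move [(0, .cup false), (1, .cup true)] [] (.straightenLeft 1 false) rfl rfl

/-- The closure of a word whose lower end is cut off. -/
def cutClosure (k j : Bool) (W : List Letter) : List Layer :=
  [cupAt false, cupAt k] ++ [cupAt j] ++ (word W ++ topCaps)

theorem run_cupAt_cupAt (k : Bool) :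
    run [] [cupAt false, cupAt k] = some [false, true, false, true] := by
  cases k <;> rfl

theorem run_cupAt (j : Bool) (r : List Bool) :
    run (false :: r) [cupAt j] = some (false :: true :: false :: r) := by
  cases j <;> simp [cupAt, run_cons, step]

theorem skeinValue_unknot_false : SkeinValue [(0, .cup false), (0, .cap)] 1 :=
  .isotopic (TangleIsotopic.isotopic (circle_flip [] 0 le_rfl true)) .unknot

theorem skeinValue_unlink_two :
    SkeinValue [(0, .cup false), (1, .cup true), (1, .cap), (0, .cap)] 0 :=
  SkeinValue.circle_right (A := [(0, .cup false)]) (B := [(0, .cap)]) (u := []) (v := [true])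
    (a := false) skeinValue_unknot_false rfl rfl true

theorem skeinValue_unlink_three : SkeinValue (closure []) 0 :=
  SkeinValue.circle_right (A := [(0, .cup false), (1, .cup true)]) (B := [(1, .cap), (0, .cap)])
    (u := [false]) (v := [false, true]) (a := true) skeinValue_unlink_two rfl rfl false

theorem skeinValue_zigzag :
    SkeinValue [(0, .cup false), (0, .cup false), (1, .cap), (0, .cap)] 1 :=
  .isotopic (TangleIsotopic.isotopic
    (move [(0, .cup false)] [(0, .cap)] (.straightenRight 0 false) rfl rfl)).symm
    skeinValue_unknot_false

/-- Equal positions close up to a two-component unlink, different ones to a zigzag, which is an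
unknot. -/
theorem skeinValue_cutClosure_nil (k j : Bool) :
    SkeinValue (cutClosure k j []) (if k = j then 0 else 1) := by
  cases k <;> cases j
  · have h : SkeinValue [(0, .cup false), (0, .cup false), (0, .cap), (0, .cap)] 0 :=
      SkeinValue.circle_left (A := [(0, .cup false)]) (B := [(0, .cap)]) (u := []) (v := [true])
        (a := false) skeinValue_unknot_false rfl rfl false
    exact .isotopic (TangleIsotopic.isotopic <|
      (move [(0, .cup false), (0, .cup false)] [(1, .cap), (0, .cap)]
        (.exchange 0 0 (.cup false) .cap) rfl rfl).trans <|
      (move [(0, .cup false), (0, .cup false), (0, .cap)] [(0, .cap)]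
        (.straightenRight 0 false) rfl rfl)).symm h
  · exact .isotopic (TangleIsotopic.isotopic <|
      (move [(0, .cup false), (0, .cup false)] [(1, .cap), (0, .cap)]
        (.straightenRight 1 true) rfl rfl)).symm skeinValue_zigzag
  · exact .isotopic (TangleIsotopic.isotopic <|
      (move [(0, .cup false), (1, .cup true)] [(1, .cap), (0, .cap)]
        (.exchange 0 0 (.cup false) .cap) rfl rfl).trans <|
      (move [(0, .cup false)] [(0, .cup false), (1, .cap), (0, .cap)]
        (.straightenLeft 0 true) rfl rfl)).symm skeinValue_zigzag
  · exact .isotopic (TangleIsotopic.isotopic <|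
      (move [(0, .cup false), (1, .cup true)] [(1, .cap), (0, .cap)]
        (.straightenRight 1 true) rfl rfl)).symm skeinValue_unlink_two

theorem SkeinValue.cutClosure_half {k j : Bool} {W : List Letter} {p : ℤ[T;T⁻¹]} (o : Bool)
    (h : SkeinValue (cutClosure k (!j) W) p) : SkeinValue (cutClosure k j (.half o :: W)) p := by
  simpa [cutClosure, Letter.layers] using
    SkeinValue.congr (r := [true, false, true]) h (cupAt_halfTwist j o) (run_cupAt_cupAt k)
      (run_word_topCaps W)

theorem SkeinValue.cutClosure_true_cut {k : Bool} {W : List Letter} {p : ℤ[T;T⁻¹]}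
    (h : SkeinValue (cutClosure k false W) p) : SkeinValue (cutClosure k true (.cut :: W)) p := by
  simpa [cutClosure, Letter.layers] using
    SkeinValue.congr (st := [false]) (t := [false, true, false]) (r := [true, false, true])
      (x := [cupAt true, capAt false, cupAt false]) h
      (move [] [cupAt false] (.straightenLeft 0 true) rfl rfl) (run_cupAt_cupAt k)
      (run_word_topCaps W)

theorem SkeinValue.cutClosure_false_cut {k : Bool} {W : List Letter} {p : ℤ[T;T⁻¹]}
    (h : SkeinValue (cutClosure k false W) p) : SkeinValue (cutClosure k false (.cut :: W)) 0 := by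
  simpa [cutClosure, Letter.layers, cupAt, capAt] using
    SkeinValue.circle_left (A := [cupAt false, cupAt k])
      (B := [cupAt false] ++ (word W ++ topCaps)) (u := []) (v := [true, false, true])
      (a := false) (by simpa [cutClosure] using h) (run_cupAt_cupAt k)
      (by rw [List.nil_append, run_append, run_cupAt]; exact run_word_topCaps W) false

theorem word_half_capAt (H : List Bool) (j : Bool) : TangleIsotopic [false, true, false] [false]
    (word (H.map .half) ++ [capAt j]) [capAt (not^[H.length] j)] := by
  induction H with
  | nil => exact refl _
  | cons o H ih =>
    rw [List.length_cons, Function.iterate_succ_apply']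
    refine trans ?_ (halfTwist_capAt _ o)
    simpa [Letter.layers] using
      ih.context (A := halfTwist o) (B := []) (run_layers (.half o)) rfl

theorem SkeinValue.closure_of_cutClosure {k j : Bool} {W : List Letter} {p : ℤ[T;T⁻¹]}
    (h : SkeinValue (cutClosure k j W) p) :
    SkeinValue (bottomCups ++ [capAt k, cupAt j] ++ (word W ++ topCaps)) p := by
  simpa [cutClosure] using SkeinValue.congr (A := []) (r := [])
      (B := [cupAt j] ++ (word W ++ topCaps)) (by simpa [cutClosure] using h) (bottomCups_capAt k)
      rfl (by rw [List.append_nil, run_append, run_cupAt]; exact run_word_topCaps W)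

/-- The maximum of the first cut absorbs the half twists below it, changing sides each time, until
it meets the three minima at the bottom. -/
theorem SkeinValue.closure_half_cut {W : List Letter} {p : ℤ[T;T⁻¹]} (H : List Bool)
    (h : SkeinValue (cutClosure (not^[H.length] false) false W) p) :
    SkeinValue (closure (H.map .half ++ .cut :: W)) p := by
  have := SkeinValue.congr (A := bottomCups) (B := [cupAt false] ++ (word W ++ topCaps))
    (r := [true, false, true]) (by simpa using h.closure_of_cutClosure) (word_half_capAt H false)
    rfl (by rw [List.cons_append, run_append, run_cupAt]; exact run_word_topCaps W)
  simpa [closure, Letter.layers] using this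

/-- The skein relation for the three crossings of a half twist. -/
theorem SkeinValue.closure_half {V : List Letter} {p q r₁ r₂ : ℤ[T;T⁻¹]} (o : Bool)
    (hp : SkeinValue (closure (.half (!o) :: V)) p) (hq : SkeinValue (closure V) q)
    (h₁ : SkeinValue (cutClosure true false V) r₁) (h₂ : SkeinValue (cutClosure false true V) r₂) :
    SkeinValue (closure (.half o :: V))
      (p + (if o then T 1 - T (-1) else -(T 1 - T (-1))) * (q - r₁ - r₂)) := by
  have hB := run_word_topCaps V
  have hA : run [] bottomCups = some ([false, true, false] ++ [true, false, true]) := rfl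
  have hz₂ : SkeinValue (bottomCups ++ [(1, .cross (!o)), (0, .cross (!o)), (1, .cap)] ++
      (cupAt true :: (word V ++ topCaps))) r₂ :=
    SkeinValue.congr (by simpa using h₂.closure_of_cutClosure) (two_crossings_capAt (!o)) hA hB
  have hz : SkeinValue (bottomCups ++ [(1, .cross (!o)), (1, .cross o)] ++ (word V ++ topCaps)) q :=
    SkeinValue.congr (st := [false, true, false]) (t := [false, true, false]) (y := [])
      (by simpa [closure] using hq) (move [] [] (.reidemeister2_not 1 o) rfl rfl) hA hB
  have hz₁ : SkeinValue ((bottomCups ++ [capAt true]) ++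
      [(1, .cup false), (0, .cross o), (1, .cross o)] ++ (word V ++ topCaps)) r₁ :=
    SkeinValue.congr (r := [true, false, true]) (by simpa using h₁.closure_of_cutClosure)
      (cupAt_two_crossings o) rfl hB
  -- The three crossings are changed from the top one down. The middle one joins parallel strands
  -- and the outer two antiparallel strands, so its term `q` enters with the sign opposite to that
  -- of `r₁` and `r₂`.
  have tr₃ := SkeinTriple.mk (bottomCups ++ [(1, .cross (!o)), (0, .cross (!o))])
    (word V ++ topCaps) [false] [true, false, true] false true rfl
    (by simp only [List.append_assoc, IsLinkDiagram]; exact hB)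
  have tr₂ := SkeinTriple.mk (bottomCups ++ [(1, .cross (!o))])
    ([(1, .cross o)] ++ (word V ++ topCaps)) [] [true, true, false, true] false false rfl
    (by simp only [List.append_assoc, IsLinkDiagram]; exact hB)
  have tr₁ := SkeinTriple.mk bottomCups ([(0, .cross o), (1, .cross o)] ++ (word V ++ topCaps))
    [false] [true, false, true] true false rfl
    (by simp only [List.append_assoc, IsLinkDiagram]; exact hB)
  cases o
  · have h := SkeinValue.positive tr₁ (SkeinValue.negative tr₂ (SkeinValue.positive tr₃
      (n := p) (z := r₂) (by simpa [closure, Letter.layers, halfTwist] using hp)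
      (by simpa [smoothing, cupAt] using hz₂)) (z := q) (by simpa [smoothing] using hz))
      (z := r₁) (by simpa [smoothing, capAt] using hz₁)
    have e : p + (if false = true then T 1 - T (-1) else -(T 1 - T (-1))) * (q - r₁ - r₂) =
      p + (T 1 - T (-1)) * r₂ - (T 1 - T (-1)) * q + (T 1 - T (-1)) * r₁ := by
      rw [if_neg Bool.false_ne_true]; ring
    rw [e]
    simpa [closure, Letter.layers, halfTwist] using h
  · have h := SkeinValue.negative tr₁ (SkeinValue.positive tr₂ (SkeinValue.negative tr₃
      (p := p) (z := r₂) (by simpa [closure, Letter.layers, halfTwist] using hp)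
      (by simpa [smoothing, cupAt] using hz₂)) (z := q) (by simpa [smoothing] using hz))
      (z := r₁) (by simpa [smoothing, capAt] using hz₁)
    have e : p + (if true = true then T 1 - T (-1) else -(T 1 - T (-1))) * (q - r₁ - r₂) =
      p - (T 1 - T (-1)) * r₂ + (T 1 - T (-1)) * q - (T 1 - T (-1)) * r₁ := by
      rw [if_pos rfl]; ring
    rw [e]
    simpa [closure, Letter.layers, halfTwist] using h

/-! ### Closures of powers of the half twist -/

theorem skeinValue_cutClosure_half (H : List Bool) (k j : Bool) :
    SkeinValue (cutClosure k j (H.map .half)) (if k = not^[H.length] j then 0 else 1) := by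
  induction H generalizing j with
  | nil => exact skeinValue_cutClosure_nil k j
  | cons o H ih => exact (ih (!j)).cutClosure_half o

/-- The Hopf link whose components bound an annulus. -/
theorem skeinValue_hopf (o : Bool) :
    SkeinValue [(0, .cup false), (1, .cup true), (0, .cross o), (0, .cross o), (1, .cap), (0, .cap)]
      (if o then -(T 1 - T (-1)) else T 1 - T (-1)) := by
  have h₁ : SkeinValue [(0, .cup false), (1, .cup true), (0, .cross (!o)), (0, .cross o),
      (1, .cap), (0, .cap)] 0 :=
    .isotopic (TangleIsotopic.isotopic <| move [(0, .cup false), (1, .cup true)]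
      [(1, .cap), (0, .cap)] (.reidemeister2_not 0 o) rfl rfl).symm skeinValue_unlink_two
  have h₂ : SkeinValue [(0, .cup false), (1, .cup true), (0, .cap), (0, .cup true), (0, .cross o),
      (1, .cap), (0, .cap)] 1 :=
    .isotopic (TangleIsotopic.isotopic <|
      (move [(0, .cup false)] [(0, .cup true), (0, .cross o), (1, .cap), (0, .cap)]
        (.straightenLeft 0 true) rfl rfl).trans <|
      (move [(0, .cup false)] [(1, .cap), (0, .cap)] (.reidemeister1Cup 0 true o) rfl rfl)).symm
      skeinValue_zigzag
  have tr := SkeinTriple.mk [(0, .cup false), (1, .cup true)]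
    [(0, .cross o), (1, .cap), (0, .cap)] [] [false, true] false true rfl rfl
  cases o
  · simpa using SkeinValue.positive tr h₁ h₂
  · simpa using SkeinValue.negative tr h₁ h₂

/-- After a Reidemeister 3 move only one crossing involves the third strand; it becomes a curl, and
removing it leaves the Hopf link. -/
theorem skeinValue_closure_half_singleton (o : Bool) :
    SkeinValue (closure [.half o]) (if o then -(T 1 - T (-1)) else T 1 - T (-1)) :=
  .isotopic (TangleIsotopic.isotopic <|
    (move bottomCups topCaps (.reidemeister3 0 o) rfl rfl).symm.trans <|
    (move [(0, .cup false), (1, .cup true)] ([(1, .cross o), (0, .cross o)] ++ topCaps)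
      (.exchange 0 0 (.cross o) (.cup false)) rfl rfl).symm.trans <|
    (move [(0, .cup false), (1, .cup true), (0, .cross o), (2, .cup false), (1, .cross o)]
      [(1, .cap), (0, .cap)] (.exchange 0 0 (.cross o) .cap) rfl rfl).trans <|
    (move [(0, .cup false), (1, .cup true), (0, .cross o)]
      [(2, .cap), (0, .cross o), (1, .cap), (0, .cap)] (.slideCup_not 1 false o) rfl rfl).symm.trans <|
    (move [(0, .cup false), (1, .cup true), (0, .cross o), (1, .cup false)]
      [(0, .cross o), (1, .cap), (0, .cap)] (.reidemeister1Cap 2 (!o)) rfl rfl).trans <|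
    (move [(0, .cup false), (1, .cup true), (0, .cross o)]
      [(0, .cross o), (1, .cap), (0, .cap)] (.straightenRight 1 false) rfl rfl)).symm
    (skeinValue_hopf o)

/-- The value of the closure of `n` half twists of three strands. -/
noncomputable def halfTwistValue (n : ℤ) : ℤ[T;T⁻¹] :=
  if Even n then 2 - T n - T (-n) else T (-n) - T n

theorem halfTwistValue_neg_of_even {n : ℤ} (h : Even n) :
    halfTwistValue (-n) = halfTwistValue n := by
  rw [halfTwistValue, halfTwistValue, if_pos h.neg, if_pos h, neg_neg]; ring

/-- The sign of a half twist. -/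
def halfSign (o : Bool) : ℤ := if o then 1 else -1

theorem not_iterate (m : ℕ) (j : Bool) : not^[m] j = if Even m then j else !j := by
  induction m with
  | zero => simp
  | succ m ih =>
    rw [Function.iterate_succ_apply', ih]
    by_cases h : Even m <;> simp [h, Nat.even_add_one]

/-- This is the recursion of `SkeinValue.closure_half` for powers of the half twist. The two
subtracted terms are the cut closures of `m + 1` half twists: unlinks for even `m`, unknots for odd
`m`. -/
theorem halfTwistValue_add_two (o : Bool) (m : ℕ) :
    halfTwistValue (halfSign o * (m + 2 : ℕ)) = halfTwistValue (halfSign o * m) +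
      (if o then T 1 - T (-1) else -(T 1 - T (-1))) *
        (halfTwistValue (halfSign o * (m + 1 : ℕ)) - (if Even m then 0 else 1) -
          (if Even m then 0 else 1)) := by
  have h1 : (T 1 * T (-1) : ℤ[T;T⁻¹]) = 1 := by rw [← T_add]; simp
  have h2 : (T (m : ℤ) * T (-m : ℤ) : ℤ[T;T⁻¹]) = 1 := by rw [← T_add]; simp
  have e : ∀ k : ℕ, Even (-(k : ℤ)) ↔ Even k := fun k => by
    rw [even_neg, Int.even_coe_nat]
  have e' : ∀ k : ℕ, Even ((k : ℤ)) ↔ Even k := fun k => Int.even_coe_nat k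
  have t1 : (T ((m + 1 : ℕ) : ℤ) : ℤ[T;T⁻¹]) = T m * T 1 := by rw [← T_add]; simp
  have t2 : (T ((m + 2 : ℕ) : ℤ) : ℤ[T;T⁻¹]) = T m * T 1 * T 1 := by
    rw [← T_add, ← T_add]; congr 1
  have t3 : (T (-((m + 1 : ℕ) : ℤ)) : ℤ[T;T⁻¹]) = T (-m) * T (-1) := by
    rw [← T_add]; congr 1; push_cast; ring
  have t4 : (T (-((m + 2 : ℕ) : ℤ)) : ℤ[T;T⁻¹]) = T (-m) * T (-1) * T (-1) := by
    rw [← T_add, ← T_add]; congr 1; push_cast; ring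
  have e1 : Even (m + 1) ↔ ¬ Even m := Nat.even_add_one
  have e2 : Even (m + 2) ↔ Even m := by simp [Nat.even_add]
  cases o <;> by_cases hm : Even m <;>
    simp only [halfSign, halfTwistValue, if_true, Bool.false_eq_true, if_false, one_mul, neg_one_mul,
      neg_neg, e, e', e1, e2, hm, t1, t2, t3, t4, not_true_eq_false, not_false_eq_true]
  all_goals
    generalize (T 1 : ℤ[T;T⁻¹]) = a at *
    generalize (T (-1) : ℤ[T;T⁻¹]) = b at *
    generalize (T (m : ℤ) : ℤ[T;T⁻¹]) = c at *
    generalize (T (-m : ℤ) : ℤ[T;T⁻¹]) = d at *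
    clear t1 t2 t3 t4
    grind

/-- A half twist followed by the opposite one. -/
theorem SkeinValue.closure_half_cancel {W : List Letter} {p : ℤ[T;T⁻¹]} (o : Bool)
    (h : SkeinValue (closure W) p) : SkeinValue (closure (.half (!o) :: .half o :: W)) p := by
  have := SkeinValue.congr (A := bottomCups) (B := word W ++ topCaps) (y := [])
    (r := [true, false, true]) (by simpa [closure] using h) (halfTwist_cancel (!o)) rfl
    (run_word_topCaps W)
  simpa [closure, Letter.layers] using this

theorem skeinValue_closure_replicate (o : Bool) (m : ℕ) :
    SkeinValue (closure ((List.replicate m o).map .half)) (halfTwistValue (halfSign o * m)) := by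
  induction m using Nat.twoStepInduction with
  | zero =>
    have : halfTwistValue (halfSign o * (0 : ℕ)) = 0 := by
      simp [halfTwistValue]; norm_num
    rw [this]
    exact skeinValue_unlink_three
  | one =>
    have : halfTwistValue (halfSign o * (1 : ℕ)) =
        if o then -(T 1 - T (-1)) else T 1 - T (-1) := by
      cases o <;> simp [halfTwistValue, halfSign]
    rw [this]
    exact skeinValue_closure_half_singleton o
  | more m ih ih' =>
    have key := fun k j => skeinValue_cutClosure_half (List.replicate (m + 1) o) k j
    have k1 := key true false
    have k2 := key false true
    rw [List.length_replicate, not_iterate] at k1 k2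
    -- With `m + 1` half twists as the remaining word, the opposite half twist in front cancels one
    -- of them, so the induction hypothesis for `m` supplies the switched term.
    have := SkeinValue.closure_half o (ih.closure_half_cancel o) ih' k1 k2
    rw [halfTwistValue_add_two]
    convert this using 4
    all_goals by_cases h : Even m <;> simp [h, Nat.even_add_one, List.replicate_succ]

theorem halves_reduce (H : List Bool) : ∃ (o : Bool) (m : ℕ),
    TangleIsotopic [false, true, false] [false, true, false] (word (H.map .half))
      (word ((List.replicate m o).map .half)) ∧ (H.map halfSign).sum = halfSign o * m := by
  induction H with
  | nil => exact ⟨true, 0, refl _, by simp⟩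
  | cons a H ih =>
    obtain ⟨o, m, h, hs⟩ := ih
    have h' : TangleIsotopic [false, true, false] [false, true, false]
        (word ((a :: H).map .half)) (word ((a :: List.replicate m o).map .half)) := by
      simpa using h.context (B := []) (run_layers (.half a)) rfl
    by_cases hao : a = o
    · subst hao
      exact ⟨a, m + 1, h', by rw [List.map_cons, List.sum_cons, hs]; push_cast; ring⟩
    · cases m with
      | zero => exact ⟨a, 1, h', by simp [hs]⟩
      | succ m =>
        obtain rfl : o = !a := by cases a <;> cases o <;> simp at hao ⊢
        refine ⟨!a, m, h'.trans ?_, ?_⟩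
        · simpa [List.replicate_succ, Letter.layers] using
            (halfTwist_cancel a).context (A := []) rfl
              (run_word ((List.replicate m (!a)).map .half))
        · rw [List.map_cons, List.sum_cons, hs]
          cases a <;> simp [halfSign]

theorem skeinValue_closure_halves (H : List Bool) :
    SkeinValue (closure (H.map .half)) (halfTwistValue (H.map halfSign).sum) := by
  obtain ⟨o, m, h, hs⟩ := halves_reduce H
  rw [hs]
  exact SkeinValue.congr (r := [true, false, true]) (skeinValue_closure_replicate o m) h rfl rfl

/-! ### Dependence of the value on the signs of the half twists -/

/-- A letter without the information which of two bands is above the other. -/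
def Letter.forget : Letter → Letter
  | .half _ => .half true
  | a => a

/-- The contribution of a letter to the number of half twists. -/
def Letter.sign : Letter → ℤ
  | .half o => halfSign o
  | _ => 0

theorem Letter.forget_eq_half {a : Letter} {o : Bool} (h : a.forget = (Letter.half o).forget) :
    ∃ o', a = .half o' := by
  cases a <;> simp [forget] at h ⊢

theorem Letter.forget_eq_cut {a : Letter} (h : a.forget = Letter.cut.forget) : a = .cut := by
  cases a <;> simp [forget] at h ⊢

theorem Letter.forget_eq_twist {a : Letter} {b : Bool} (h : a.forget = (Letter.twist b).forget) :
    a = .twist b := by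
  cases a <;> simp [forget] at h ⊢
  exact h

/-- The minimum at the lower end travels up through the word: a half twist of either sign moves it
to the other side, and a cut either straightens it or splits off a circle, which gives `0`. -/
theorem exists_skeinValue_cutClosure (W : List Letter) (hW : ∀ b, .twist b ∉ W) (k j : Bool) :
    ∃ p, ∀ W', W'.map Letter.forget = W.map Letter.forget → SkeinValue (cutClosure k j W') p := by
  induction W generalizing j with
  | nil => exact ⟨_, fun W' h => by
      obtain rfl : W' = [] := by simpa using h
      exact skeinValue_cutClosure_nil k j⟩
  | cons a W ih =>
    have hW' : ∀ b, .twist b ∉ W := fun b hb => hW b (List.mem_cons_of_mem _ hb)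
    cases a with
    | twist b => exact absurd List.mem_cons_self (hW b)
    | half o =>
      obtain ⟨p, hp⟩ := ih hW' (!j)
      refine ⟨p, fun W' h => ?_⟩
      obtain ⟨a', V, rfl, ha, hV⟩ := List.map_eq_cons_iff.1 h
      obtain ⟨o', rfl⟩ := Letter.forget_eq_half ha
      exact (hp V hV).cutClosure_half o'
    | cut =>
      obtain ⟨p, hp⟩ := ih hW' false
      cases j
      · refine ⟨0, fun W' h => ?_⟩
        obtain ⟨a', V, rfl, ha, hV⟩ := List.map_eq_cons_iff.1 h
        obtain rfl := Letter.forget_eq_cut ha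
        exact (hp V hV).cutClosure_false_cut
      · refine ⟨p, fun W' h => ?_⟩
        obtain ⟨a', V, rfl, ha, hV⟩ := List.map_eq_cons_iff.1 h
        obtain rfl := Letter.forget_eq_cut ha
        exact (hp V hV).cutClosure_true_cut

/-- The prefix `H` collects the half twists before the first cut; only the parity of their number
matters when its maximum absorbs them. -/
theorem exists_skeinValue_closure_half_append (n : ℕ) (W : List Letter) (hW : ∀ b, .twist b ∉ W)
    (hc : .cut ∈ W) : ∃ p, ∀ (H : List Bool) (W' : List Letter), H.length = n →
      W'.map Letter.forget = W.map Letter.forget → SkeinValue (closure (H.map .half ++ W')) p := by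
  induction W generalizing n with
  | nil => simp at hc
  | cons a W ih =>
    have hW' : ∀ b, .twist b ∉ W := fun b hb => hW b (List.mem_cons_of_mem _ hb)
    cases a with
    | twist b => exact absurd List.mem_cons_self (hW b)
    | half o =>
      obtain ⟨p, hp⟩ := ih (n + 1) hW' (by simpa using hc)
      refine ⟨p, fun H W' hH h => ?_⟩
      obtain ⟨a', V, rfl, ha, hV⟩ := List.map_eq_cons_iff.1 h
      obtain ⟨o', rfl⟩ := Letter.forget_eq_half ha
      simpa using hp (H ++ [o']) V (by simp [hH]) hV
    | cut =>
      obtain ⟨p, hp⟩ := exists_skeinValue_cutClosure W hW' (not^[n] false) false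
      refine ⟨p, fun H W' hH h => ?_⟩
      obtain ⟨a', V, rfl, ha, hV⟩ := List.map_eq_cons_iff.1 h
      obtain rfl := Letter.forget_eq_cut ha
      exact SkeinValue.closure_half_cut H (by rw [hH]; exact hp V hV)

/-- Whether a letter is a full twist. -/
def Letter.isTwist : Letter → Bool
  | .twist _ => true
  | _ => false

/-- Words with a cut band have a value which does not depend on the order of the bands. -/
theorem exists_skeinValue_closure_of_cut (W : List Letter) (hc : .cut ∈ W) :
    ∃ p, ∀ W', W'.map Letter.forget = W.map Letter.forget → SkeinValue (closure W') p := by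
  by_cases hW : ∀ b, .twist b ∉ W
  · obtain ⟨p, hp⟩ := exists_skeinValue_closure_half_append 0 W hW hc
    exact ⟨p, fun W' h => by simpa using hp [] W' rfl h⟩
  · push Not at hW
    obtain ⟨b, hb⟩ := hW
    obtain ⟨U, V, hUV⟩ := List.append_of_mem hb
    obtain ⟨p, hp⟩ := exists_skeinValue_closure_of_cut (U ++ V) (by simpa [hUV] using hc)
    obtain ⟨q, hq⟩ := exists_skeinValue_closure_of_cut (U ++ .cut :: V) (by simp)
    refine ⟨p + (if b then T 1 - T (-1) else -(T 1 - T (-1))) * q, fun W' h => ?_⟩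
    rw [hUV, List.map_append, List.map_cons] at h
    obtain ⟨U', X, rfl, hU, hX⟩ := List.map_eq_append_iff.1 h
    obtain ⟨a, V', rfl, ha, hV⟩ := List.map_eq_cons_iff.1 hX
    obtain rfl := Letter.forget_eq_twist ha
    exact (hp (U' ++ V') (by simp [hU, hV])).twist b (hq (U' ++ .cut :: V') (by simp [hU, hV]))
termination_by W.countP Letter.isTwist
decreasing_by all_goals simp [hUV, List.countP_append, List.countP_cons, Letter.isTwist]

theorem exists_eq_map_half (W : List Letter) (hW : ∀ b, .twist b ∉ W) (hc : .cut ∉ W) :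
    ∃ H : List Bool, W = H.map .half := by
  induction W with
  | nil => exact ⟨[], rfl⟩
  | cons a W ih =>
    obtain ⟨H, rfl⟩ := ih (fun b hb => hW b (List.mem_cons_of_mem _ hb))
      (fun h => hc (List.mem_cons_of_mem _ h))
    cases a with
    | twist b => exact absurd List.mem_cons_self (hW b)
    | half o => exact ⟨o :: H, rfl⟩
    | cut => exact absurd List.mem_cons_self hc

/-- Words without a cut band have a value which depends on the order of the bands only through the
number of half twists. -/
theorem exists_skeinValue_closure (W : List Letter) (hc : .cut ∉ W) :
    ∃ p, ∀ W', W'.map Letter.forget = W.map Letter.forget →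
      SkeinValue (closure W') (p + halfTwistValue (W'.map Letter.sign).sum) := by
  by_cases hW : ∀ b, .twist b ∉ W
  · refine ⟨0, fun W' h => ?_⟩
    have hmem : ∀ a ∈ W', ∃ a' ∈ W, a.forget = a'.forget := fun a ha => by
      have : a.forget ∈ W.map Letter.forget := h ▸ List.mem_map_of_mem ha
      obtain ⟨a', ha', e⟩ := List.mem_map.1 this
      exact ⟨a', ha', e.symm⟩
    obtain ⟨H, rfl⟩ := exists_eq_map_half W'
      (fun b hb => by
        obtain ⟨a, ha, e⟩ := hmem _ hb
        exact hW b (Letter.forget_eq_twist e.symm ▸ ha))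
      (fun hb => by
        obtain ⟨a, ha, e⟩ := hmem _ hb
        exact hc (Letter.forget_eq_cut e.symm ▸ ha))
    simpa [Function.comp_def, Letter.sign] using skeinValue_closure_halves H
  · push Not at hW
    obtain ⟨b, hb⟩ := hW
    obtain ⟨U, V, hUV⟩ := List.append_of_mem hb
    -- Deleting the twist keeps the word free of cuts and carries the dependence on the signs;
    -- cutting the band contributes only to the common constant.
    obtain ⟨p, hp⟩ := exists_skeinValue_closure (U ++ V) (by simpa [hUV] using hc)
    obtain ⟨q, hq⟩ := exists_skeinValue_closure_of_cut (U ++ .cut :: V) (by simp)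
    refine ⟨p + (if b then T 1 - T (-1) else -(T 1 - T (-1))) * q, fun W' h => ?_⟩
    rw [hUV, List.map_append, List.map_cons] at h
    obtain ⟨U', X, rfl, hU, hX⟩ := List.map_eq_append_iff.1 h
    obtain ⟨a, V', rfl, ha, hV⟩ := List.map_eq_cons_iff.1 hX
    obtain rfl := Letter.forget_eq_twist ha
    have := (hp (U' ++ V') (by simp [hU, hV])).twist b
      (hq (U' ++ .cut :: V') (by simp [hU, hV]))
    rw [add_right_comm]
    simpa [Letter.sign] using this
termination_by W.countP Letter.isTwist
decreasing_by all_goals simp [hUV, List.countP_append, List.countP_cons, Letter.isTwist]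

theorem TangleIsotopic.flatMap {ι : Type*} {st : List Bool} {f g : ι → List Layer}
    (h : ∀ i, TangleIsotopic st st (f i) (g i)) (hf : ∀ i, run st (f i) = some st)
    (hg : ∀ i, run st (g i) = some st) (l : List ι) :
    TangleIsotopic st st (l.flatMap f) (l.flatMap g) := by
  have run_flatMap : ∀ l : List ι, run st (l.flatMap g) = some st := fun l => by
    induction l with
    | nil => rfl
    | cons i l ih => rw [List.flatMap_cons, run_append, hg, Option.bind_some, ih]
  induction l with
  | nil => exact TangleIsotopic.refl _
  | cons i l ih =>
    have h₁ := ih.context (A := f i) (B := []) (hf i) rfl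
    have h₂ := (h i).context (A := []) rfl (run_flatMap l)
    simpa using h₁.trans (by simpa using h₂)

/-! ### The links of cyclic plumbings -/

/-- The word of a cyclic plumbing of Hopf bands. -/
def plumbingWord {l : ℕ} (w : Equiv.Perm (Fin l)) : List Letter :=
  (List.finRange l).flatMap fun i : Fin l =>
    [.twist (decide (Even (i : ℕ))), .half (decide (w (finRotate l i) < w i))]

theorem plumbingLink_isotopic {l : ℕ} (w : Equiv.Perm (Fin l)) :
    Isotopic (plumbingLink w) (closure (plumbingWord w)) := by
  have h := TangleIsotopic.flatMap (st := [false, true, false])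
    (f := fun i : Fin l => fullTwist (decide (Even (i : ℕ))) ++
      bandCrossing (decide (w (finRotate l i) < w i)))
    (g := fun i : Fin l => word [.twist (decide (Even (i : ℕ))),
      .half (decide (w (finRotate l i) < w i))])
    (fun i => by
      simpa [Letter.layers] using (bandCrossing_halfTwist (decide (w (finRotate l i) < w i))).context
        (A := fullTwist (decide (Even (i : ℕ)))) (B := []) rfl rfl)
    (fun i => rfl) (fun i => run_word _) (List.finRange l)
  have h' := (h.append_right [true, false, true]).context (st' := []) (t' := [])
    (A := bottomCups) (B := topCaps) rfl rfl
  have e : word (plumbingWord w) = (List.finRange l).flatMap (fun i : Fin l =>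
      word [.twist (decide (Even (i : ℕ))), .half (decide (w (finRotate l i) < w i))]) := by
    simp only [word, plumbingWord, List.flatMap_assoc]
  rw [closure, e]
  exact h'.isotopic

theorem cut_notMem_plumbingWord {l : ℕ} (w : Equiv.Perm (Fin l)) : .cut ∉ plumbingWord w := by
  simp [plumbingWord]

theorem forget_plumbingWord {l : ℕ} (w w' : Equiv.Perm (Fin l)) :
    (plumbingWord w).map Letter.forget = (plumbingWord w').map Letter.forget := by
  simp [plumbingWord, List.map_flatMap, Letter.forget]

theorem finRotate_ne_self {l : ℕ} (hl : Even l) (i : Fin l) : finRotate l i ≠ i := by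
  obtain _ | _ | l := l
  · exact i.elim0
  · simp at hl
  · rw [finRotate_apply]
    simp

theorem sign_plumbingWord {l : ℕ} (hl : Even l) (w : Equiv.Perm (Fin l)) :
    ((plumbingWord w).map Letter.sign).sum = -flowDifference w := by
  have h : ((plumbingWord w).map Letter.sign).sum =
      ∑ i : Fin l, halfSign (decide (w (finRotate l i) < w i)) := by
    rw [plumbingWord, Fin.sum_univ_def]
    induction List.finRange l with
    | nil => rfl
    | cons i L ih =>
      rw [List.flatMap_cons, List.map_append, List.sum_append, ih, List.map_cons, List.sum_cons]
      congr 1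
      exact (zero_add _).trans (add_zero _)
  rw [h, flowDifference, ← Finset.sum_neg_distrib]
  refine Finset.sum_congr rfl fun i _ => ?_
  have hne : w (finRotate l i) ≠ w i := fun h => finRotate_ne_self hl i (w.injective h)
  rcases lt_or_gt_of_ne hne with h | h
  · rw [decide_eq_true h, if_neg h.not_gt]; rfl
  · rw [decide_eq_false h.not_gt, if_pos h]; rfl

theorem even_flowDifference {l : ℕ} (hl : Even l) (w : Equiv.Perm (Fin l)) :
    Even (flowDifference w) := by
  have h : Even (∑ i : Fin l, ((if w i < w (finRotate l i) then (1 : ℤ) else -1) + 1)) :=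
    Finset.even_sum _ fun i _ => by split_ifs <;> decide
  rw [Finset.sum_add_distrib] at h
  have hl' : Even (∑ _i : Fin l, (1 : ℤ)) := by simpa using hl
  exact (Int.even_add.1 h).2 hl'

theorem exists_isAlexanderPolynomial_plumbingLink {l : ℕ} (hl : Even l) :
    ∃ p : ℤ[T;T⁻¹], ∀ w : Equiv.Perm (Fin l),
      IsAlexanderPolynomial (plumbingLink w) (p + halfTwistValue (flowDifference w)) := by
  obtain ⟨p, hp⟩ := exists_skeinValue_closure (plumbingWord (1 : Equiv.Perm (Fin l)))
    (cut_notMem_plumbingWord _)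
  refine ⟨p, fun w => SkeinValue.isAlexanderPolynomial ?_⟩
  have := hp (plumbingWord w) (forget_plumbingWord _ _)
  -- The half twists count minus the flow difference; the sign is immaterial because
  -- `halfTwistValue` is symmetric on even integers, and the flow difference is even when `l` is.
  rw [sign_plumbingWord hl, halfTwistValue_neg_of_even (even_flowDifference hl w)] at this
  exact .isotopic (plumbingLink_isotopic w).symm this

end HopfPlumbing

theorem proposition5p3 (l : ℕ) (hl : Even l) (d : ℕ) (w w' : Equiv.Perm (Fin l))
    (hw : HopfPlumbing.flowDifference w = (d : ℤ))
    (hw' : HopfPlumbing.flowDifference w' = (d : ℤ) + 2) :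
    ∃ Δ Δ' : LaurentPolynomial ℤ,
      HopfPlumbing.IsAlexanderPolynomial (HopfPlumbing.plumbingLink w) Δ ∧
      HopfPlumbing.IsAlexanderPolynomial (HopfPlumbing.plumbingLink w') Δ' ∧
      Δ - Δ' = (LaurentPolynomial.T 1 - LaurentPolynomial.T (-1)) *
        (LaurentPolynomial.T ((d : ℤ) + 1) - LaurentPolynomial.T (-((d : ℤ) + 1))) := by
  obtain ⟨p, hp⟩ := HopfPlumbing.exists_isAlexanderPolynomial_plumbingLink hl
  refine ⟨_, _, hp w, hp w', ?_⟩
  rw [HopfPlumbing.halfTwistValue, HopfPlumbing.halfTwistValue,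
    if_pos (HopfPlumbing.even_flowDifference hl w), if_pos (HopfPlumbing.even_flowDifference hl w'),
    hw, hw']
  simp only [mul_sub, sub_mul, ← LaurentPolynomial.T_add]
  ring_nf
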